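/- Work in a monster model $\mathfrak U$ of a complete first-order (possibly many-sorted) theory in a language $L$, i.e. a saturated model with $|\mathfrak U|>|L|+\aleph_0$; a subset of $\mathfrak U$ is small if its cardinality is $<|\mathfrak U|$. Let $x$ be a finite tuple of variables, let $\mathfrak p(x)\in S_x(\mathfrak U)$ be a global type, and write $\mathfrak p_{\restriction A}$ for its restriction to $A$. Definitions. $\mathfrak p$ is non-algebraic if no formula in $\mathfrak p$ has only finitely many solutions in $\mathfrak U$. $\mathfrak p$ is $A$-invariant if $(\phi(x,b_1)\leftrightarrow\phi(x,b_2))\in\mathfrak p$ for all $L_A$-formulas $\phi(x,y)$ and all finite tuples $b_1,b_2$ with $\mathrm{tp}(b_1/A)=\mathrm{tp}(b_2/A)$. For a linear order $(I,<)$, a sequence $(a_i\mid i\in I)$ of tuples in $\mathfrak U$ is a Morley sequence in $\mathfrak p$ over $A$ if $a_i\models\mathfrak p_{\restriction A\cup\{a_j\mid j<i\}}$ for all $i\in I$. $\mathfrak p$ is order-trivial over $A$ if it is non-algebraic, $A$-invariant, and every sequence $(a_i\mid i<\omega)$ such that $(a_i,a_{i+1})$ is a Morley sequence in $\mathfrak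 p$ over $A$ for each $i<\omega$ is a Morley sequence in $\mathfrak p$ over $A$. A partial type $q(x)$ over $A$ is NIP if there are no formula $\varphi(x,y)$, $A$-indiscernible sequence $(a_n\mid n<\omega)$ of realizations of $q$, and finite tuple $b$ such that, for all $n<\omega$, $\models\varphi(a_n,b)$ if and only if $n$ is even. Theorem. Let $A$ be small, and suppose that $\mathfrak p$ is order-trivial over $A$ and that $\mathfrak p_{\restriction A}$ is NIP. Then: (1) $\mathfrak p$ is order-trivial over every small $B\supseteq A$. (2) If $(a_i\mid i<\omega)$ is a Morley sequence in $\mathfrak p$ over $A$ and $B\supseteq A$ is small, then $(a_i\mid i<\omega)$ is a Morley sequence in $\mathfrak p$ over $B$ if and only if $a_0\models\mathfrak p_{\restriction B}$. -/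

import Mathlib

open Cardinal

universe u v w x y

namespace ManySorted

/-- A many-sorted first-order language. A function symbol has a list of argument sorts and a value
sort, a relation symbol has a list of argument sorts. One-sorted logic is the case `Sorts = Unit`. -/
structure Language where
  /-- The sorts. -/
  Sorts : Type u
  /-- The function symbols (constants for `n = 0`). -/
  Functions : {n : ℕ} → (Fin n → Sorts) → Sorts → Type v
  /-- The relation symbols. -/
  Relations : {n : ℕ} → (Fin n → Sorts) → Type v

/-- The number of sorts and symbols of a language. -/
noncomputable def Language.card (L : Language.{u, v}) : Cardinal.{max u v} :=
  #(L.Sorts ⊕ (Σ (n : ℕ) (τ : Fin n → L.Sorts) (s : L.Sorts), L.Functions τ s) ⊕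
    (Σ (n : ℕ) (τ : Fin n → L.Sorts), L.Relations τ))

/-- An `L`-structure on a family of carriers, one for every sort. -/
class Struct (L : Language.{u, v}) (M : L.Sorts → Type w) where
  /-- Interpretation of function symbols. -/
  funMap : ∀ {n : ℕ} {τ : Fin n → L.Sorts} {s : L.Sorts},
    L.Functions τ s → (∀ i, M (τ i)) → M s
  /-- Interpretation of relation symbols. -/
  relMap : ∀ {n : ℕ} {τ : Fin n → L.Sorts}, L.Relations τ → (∀ i, M (τ i)) → Prop

section SyntaxAndSemantics

variable {L : Language.{u, v}}

/-- Terms of sort `s` in a context `X`, where `X t` is the collection of variables of sort `t`. -/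
inductive Term (L : Language.{u, v}) (X : L.Sorts → Type x) : L.Sorts → Type (max u v x)
  | var {s : L.Sorts} (a : X s) : Term L X s
  | func {n : ℕ} {τ : Fin n → L.Sorts} {s : L.Sorts} (f : L.Functions τ s)
      (ts : ∀ i, Term L X (τ i)) : Term L X s

/-- The context `X` enlarged by one new variable of sort `s`. -/
inductive Extend {S : Type u} (X : S → Type x) (s t : S) : Type x
  | old (a : X t) : Extend X s t
  | new (h : s = t) : Extend X s t

/-- First-order formulas whose free variables are in the context `X`. -/
inductive Formula (L : Language.{u, v}) : (L.Sorts → Type x) → Type (max u v (x + 1))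
  | falsum {X : L.Sorts → Type x} : Formula L X
  | equal {X : L.Sorts → Type x} {s : L.Sorts} (t₁ t₂ : Term L X s) : Formula L X
  | rel {X : L.Sorts → Type x} {n : ℕ} {τ : Fin n → L.Sorts} (R : L.Relations τ)
      (ts : ∀ i, Term L X (τ i)) : Formula L X
  | imp {X : L.Sorts → Type x} (φ ψ : Formula L X) : Formula L X
  | all {X : L.Sorts → Type x} (s : L.Sorts) (φ : Formula L (Extend X s)) : Formula L X

/-- Renaming of variables in a term. -/
def Term.rename {X : L.Sorts → Type x} {Y : L.Sorts → Type y} (f : ∀ s, X s → Y s) :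
    ∀ {s : L.Sorts}, Term L X s → Term L Y s
  | _, .var a => .var (f _ a)
  | _, .func g ts => .func g fun i => (ts i).rename f

/-- The renaming induced on the enlarged contexts; the new variable stays fixed. -/
def Extend.map {S : Type u} {X : S → Type x} {Y : S → Type y} (f : ∀ s, X s → Y s) (s : S) :
    ∀ t, Extend X s t → Extend Y s t
  | t, .old a => .old (f t a)
  | _, .new h => .new h

/-- Renaming of free variables in a formula. -/
def Formula.rename : ∀ {X : L.Sorts → Type x} {Y : L.Sorts → Type y},
    (∀ s, X s → Y s) → Formula L X → Formula L Y
  | _, _, _, .falsum => .falsum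
  | _, _, f, .equal t₁ t₂ => .equal (t₁.rename f) (t₂.rename f)
  | _, _, f, .rel R ts => .rel R fun i => (ts i).rename f
  | _, _, f, .imp φ ψ => .imp (φ.rename f) (ψ.rename f)
  | _, _, f, .all s φ => .all s (φ.rename (Extend.map f s))

/-- Negation. -/
def Formula.not {X : L.Sorts → Type x} (φ : Formula L X) : Formula L X := φ.imp .falsum

/-- The biconditional, that is `¬ ((φ → ψ) → ¬ (ψ → φ))`. -/
def Formula.iff {X : L.Sorts → Type x} (φ ψ : Formula L X) : Formula L X :=
  ((φ.imp ψ).imp (ψ.imp φ).not).not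

/-- A tuple of elements of `M` indexed by the variables of `X`, respecting sorts. -/
abbrev Tuple {S : Type u} (M : S → Type w) (X : S → Type x) : Type (max u w x) :=
  ∀ s, X s → M s

/-- The tuple `a` together with the value `m` for the new variable. -/
def Tuple.extend {S : Type u} {M : S → Type w} {X : S → Type x} (a : Tuple M X) {s : S} (m : M s) :
    Tuple M (Extend X s)
  | t, .old b => a t b
  | _, .new h => h ▸ m

variable {M : L.Sorts → Type w} [Struct L M]

/-- The value of a term. -/
def Term.realize {X : L.Sorts → Type x} (a : Tuple M X) : ∀ {s : L.Sorts}, Term L X s → M s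
  | _, .var b => a _ b
  | _, .func f ts => Struct.funMap f fun i => (ts i).realize a

/-- Truth of a formula in `M` at a tuple. -/
def Formula.Realize : ∀ {X : L.Sorts → Type x}, Formula L X → Tuple M X → Prop
  | _, .falsum, _ => False
  | _, .equal t₁ t₂, a => t₁.realize a = t₂.realize a
  | _, .rel R ts, a => Struct.relMap R fun i => (ts i).realize a
  | _, .imp φ ψ, a => φ.Realize a → ψ.Realize a
  | _, .all s φ, a => ∀ m : M s, φ.Realize (Tuple.extend a m)

end SyntaxAndSemantics

section Parameters

variable {L : Language.{u, v}} {M : L.Sorts → Type w}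

/-- The elements of sort `s` of a set `C` of elements of `M`. -/
abbrev Params (C : Set (Σ s, M s)) (s : L.Sorts) : Type w := {m : M s // (⟨s, m⟩ : Σ s, M s) ∈ C}

/-- `L_C`-formulas in the variables `X`: formulas in which the elements of `C` may occur as
additional symbols, which are always interpreted by themselves. -/
abbrev ParamFormula (C : Set (Σ s, M s)) (X : L.Sorts → Type x) :
    Type (max u v ((max x w) + 1)) :=
  Formula L (fun s => X s ⊕ Params C s)

/-- Truth of an `L_C`-formula `φ(x)` at the tuple `a`. -/
def ParamFormula.Holds [Struct L M] {C : Set (Σ s, M s)} {X : L.Sorts → Type x}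
    (φ : ParamFormula C X) (a : Tuple M X) : Prop :=
  Formula.Realize φ fun s => Sum.elim (a s) (fun m : Params C s => m.1)

/-- An `L_A`-formula viewed as an `L_C`-formula, for `A ⊆ C`. -/
def ParamFormula.lift {A C : Set (Σ s, M s)} (h : A ⊆ C) {X : L.Sorts → Type x}
    (φ : ParamFormula A X) : ParamFormula C X :=
  Formula.rename (fun _ => Sum.map id fun m => ⟨m.1, h m.2⟩) φ

/-- The `L_M`-formula `φ(x, b)` obtained from an `L_A`-formula `φ(x, y)` and a tuple `b`. -/
def ParamFormula.plug {A : Set (Σ s, M s)} {X : L.Sorts → Type x} {Y : L.Sorts → Type y}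
    (φ : ParamFormula A (fun s => X s ⊕ Y s)) (b : Tuple M Y) :
    ParamFormula (Set.univ : Set (Σ s, M s)) X :=
  Formula.rename (fun s => Sum.elim
    (Sum.elim Sum.inl fun i => Sum.inr ⟨b s i, Set.mem_univ _⟩)
    (fun m => Sum.inr ⟨m.1, Set.mem_univ _⟩)) φ

variable [Struct L M]

/-- The tuple `a` realizes the set `q` of `L_C`-formulas. -/
def Realizes {C : Set (Σ s, M s)} {X : L.Sorts → Type x} (a : Tuple M X)
    (q : Set (ParamFormula C X)) : Prop :=
  ∀ φ ∈ q, φ.Holds a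

/-- The type of `a` over `C`. -/
def tp (C : Set (Σ s, M s)) {X : L.Sorts → Type x} (a : Tuple M X) : Set (ParamFormula C X) :=
  {φ | φ.Holds a}

/-- Complete types over `C` in the variables `X`: sets of `L_C`-formulas that are finitely
satisfiable in `M` and contain every `L_C`-formula or its negation. -/
structure IsCompleteType {C : Set (Σ s, M s)} {X : L.Sorts → Type x}
    (q : Set (ParamFormula C X)) : Prop where
  finitely_satisfiable : ∀ F ⊆ q, F.Finite → ∃ a : Tuple M X, Realizes a F
  complete : ∀ φ : ParamFormula C X, φ ∈ q ∨ Formula.not φ ∈ q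

/-- The restriction of `p` to `A ⊆ C`. -/
def restrict {C : Set (Σ s, M s)} {X : L.Sorts → Type x} (p : Set (ParamFormula C X))
    (A : Set (Σ s, M s)) (h : A ⊆ C) : Set (ParamFormula A X) :=
  {φ | φ.lift h ∈ p}

variable (L M) in
/-- `M` is a saturated structure: every complete type in finitely many variables over a set of
fewer than `|M|` parameters is realized in `M`. -/
def IsSaturated : Prop :=
  ∀ A : Set (Σ s, M s), #A < #(Σ s, M s) →
    ∀ (X : L.Sorts → Type) [Finite (Σ s, X s)] (q : Set (ParamFormula A X)),
      IsCompleteType q → ∃ a : Tuple M X, Realizes a q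

variable (L M) in
/-- `M` is a monster model (of its complete theory): a saturated structure that is uncountable and
larger than the language. -/
structure IsMonster : Prop where
  uncountable : ℵ₀ < #(Σ s, M s)
  card_language_lt : Cardinal.lift.{w} L.card < Cardinal.lift.{v} #(Σ s, M s)
  saturated : IsSaturated L M

/-- A set of `L_M`-formulas in the variables `X`; global types are those that satisfy
`IsCompleteType`. -/
abbrev GlobalSet (M : L.Sorts → Type w) (X : L.Sorts → Type x) :
    Type (max u v ((max x w) + 1)) :=
  Set (ParamFormula (Set.univ : Set (Σ s, M s)) X)

variable {X : L.Sorts → Type}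

/-- The restriction of a global type to `A`. -/
def GlobalSet.on (p : GlobalSet M X) (A : Set (Σ s, M s)) : Set (ParamFormula A X) :=
  restrict p A (Set.subset_univ A)

/-- `p` is non-algebraic: no formula in `p` has only finitely many solutions in `M`. -/
def IsNonAlgebraic (p : GlobalSet M X) : Prop :=
  ∀ φ ∈ p, ¬ {a : Tuple M X | φ.Holds a}.Finite

/-- `p` is `A`-invariant: `(φ(x, b₁) ↔ φ(x, b₂)) ∈ p` for all `L_A`-formulas `φ(x, y)` and all
finite tuples `b₁`, `b₂` with the same type over `A`. -/
def IsInvariant (p : GlobalSet M X) (A : Set (Σ s, M s)) : Prop :=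
  ∀ (Y : L.Sorts → Type) [Finite (Σ s, Y s)] (φ : ParamFormula A (fun s => X s ⊕ Y s))
    (b₁ b₂ : Tuple M Y), tp A b₁ = tp A b₂ → Formula.iff (φ.plug b₁) (φ.plug b₂) ∈ p

/-- The set of all entries of the tuples `a j`, `j < i`. -/
def entriesBelow {I : Type y} [LinearOrder I] (a : I → Tuple M X) (i : I) : Set (Σ s, M s) :=
  {e | ∃ j < i, ∃ k : X e.1, a j e.1 k = e.2}

/-- `(a i ∣ i ∈ I)` is a Morley sequence in `p` over `A`: every `a i` realizes the restriction of
`p` to `A` together with all earlier `a j`. -/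
def IsMorley {I : Type y} [LinearOrder I] (p : GlobalSet M X) (A : Set (Σ s, M s))
    (a : I → Tuple M X) : Prop :=
  ∀ i, Realizes (a i) (p.on (A ∪ entriesBelow a i))

/-- `p` is order-trivial over `A`. -/
structure IsOrderTrivial (p : GlobalSet M X) (A : Set (Σ s, M s)) : Prop where
  nonAlgebraic : IsNonAlgebraic p
  invariant : IsInvariant p A
  isMorley : ∀ a : ℕ → Tuple M X, (∀ i, IsMorley p A ![a i, a (i + 1)]) → IsMorley p A a

/-- The concatenation of the tuples `a (f 0), …, a (f (k - 1))`. -/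
def concat (a : ℕ → Tuple M X) {k : ℕ} (f : Fin k → ℕ) : Tuple M (fun s => Fin k × X s) :=
  fun s i => a (f i.1) s i.2

/-- `(a n ∣ n < ω)` is indiscernible over `A`. -/
def IsIndiscernible (A : Set (Σ s, M s)) (a : ℕ → Tuple M X) : Prop :=
  ∀ (k : ℕ) (f g : Fin k → ℕ), StrictMono f → StrictMono g →
    tp A (concat a f) = tp A (concat a g)

/-- The partial type `q(x)` over `A` is NIP: there are no formula `φ(x, y)`, `A`-indiscernible
sequence of realizations of `q` and finite tuple `b` such that `φ(a n, b)` holds exactly for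
even `n`. -/
def IsNIP {A : Set (Σ s, M s)} (q : Set (ParamFormula A X)) : Prop :=
  ¬ ∃ (Y : L.Sorts → Type) (_ : Finite (Σ s, Y s)) (φ : Formula L (fun s => X s ⊕ Y s))
    (a : ℕ → Tuple M X) (b : Tuple M Y), IsIndiscernible A a ∧ (∀ n, Realizes (a n) q) ∧
      ∀ n, φ.Realize (fun s => Sum.elim (a n s) (b s)) ↔ Even n

end Parameters

end ManySorted

/-! The heart is a one-step extension property: if `a₀` realizes `p` over `B` and `a₁` realizes `p`
over `A ∪ a₀`, then `a₁` realizes `p` over `B ∪ a₀` (`RealizesOver.union_entries`). Part (2) follows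
by induction along the Morley sequence, with `B` and the earlier terms in the role of `B`. Part (1)
follows from (2): a sequence whose consecutive pairs are Morley over `B` is Morley over `A` by
order-triviality, and its first term realizes `p` over `B`.

Suppose the one-step property fails. Then some `B`-definable `R` has `R(x, a₀)` in `p` but not
`R(a₁, a₀)`. For a realization `d` of `p` over `B`, both truth values of `R(d', d)` occur for
suitable `d'` realizing `p` over `A ∪ d`. Hence every pattern `S` is realized by `R(c(2i+1), c(2i))`
along a chain whose consecutive pairs are Morley over `A` (`exists_chain_pattern`). By
order-triviality all these chains are Morley over `A`, so they have the same type over `A`.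
Transporting them to one fixed chain `c` moves the pattern into the parameters of `R`: the pairs
from `c` are shattered (`MorleyOver.exists_pattern`).

NIP is assumed only for single realizations of `p` over `A`, so pairs must be reduced to singletons.
Under NIP, every definable predicate is eventually constant along the terms `c(2i)`. Replacing them
by one limit `d` leaves an independence pattern in the other coordinate alone (`exists_shattered`).
A coheir Morley sequence turns it into an indiscernible alternating sequence
(`exists_indiscernible_alternating`), which contradicts NIP.

Throughout, `p` is represented by an ultrafilter `U` on tuples, and formulas by the predicates they
define. -/

namespace ManySorted

/-! ### Definable predicates, closure properties and finite support -/

section Definability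

theorem Tuple.extend_map {S : Type u} {N : S → Type w} {X : S → Type x} {Y : S → Type y}
    (f : ∀ s, X s → Y s) (a : Tuple N Y) {s : S} (m : N s) :
    (fun t z => Tuple.extend a m t (Extend.map f s t z)) =
      Tuple.extend (fun s z => a s (f s z)) m := by
  funext t z
  cases z with
  | old b => rfl
  | new h => rfl

variable {L : Language.{u, v}} {M : L.Sorts → Type w} [Struct L M]

theorem Term.realize_rename {X : L.Sorts → Type x} {Y : L.Sorts → Type y} (f : ∀ s, X s → Y s)
    (a : Tuple M Y) {s : L.Sorts} (t : Term L X s) :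
    (t.rename f).realize a = t.realize fun s z => a s (f s z) := by
  induction t with
  | var b => rfl
  | func g ts ih =>
    simp only [Term.rename, Term.realize]
    congr 1
    funext i
    exact ih i

theorem Formula.realize_rename {X : L.Sorts → Type x} (φ : Formula L X) :
    ∀ {Y : L.Sorts → Type y} (f : ∀ s, X s → Y s) (a : Tuple M Y),
      (φ.rename f).Realize a ↔ φ.Realize fun s z => a s (f s z) := by
  induction φ with
  | falsum => intros; rfl
  | equal t₁ t₂ =>
    intro Y f a
    simp only [Formula.rename, Formula.Realize, Term.realize_rename]
  | rel R ts =>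
    intro Y f a
    simp only [Formula.rename, Formula.Realize, Term.realize_rename]
  | imp φ ψ ih₁ ih₂ =>
    intro Y f a
    simp only [Formula.rename, Formula.Realize, ih₁, ih₂]
  | all s φ ih =>
    intro Y f a
    simp only [Formula.rename, Formula.Realize, ih, Tuple.extend_map]

/-- The context of the variables of `X` that belong to `F`. -/
abbrev Within {S : Type u} {X : S → Type x} (F : Set (Σ s, X s)) (s : S) : Type x :=
  {z : X s // (⟨s, z⟩ : Σ s, X s) ∈ F}

theorem Term.exists_finite_support {X : L.Sorts → Type x} {s : L.Sorts} (t : Term L X s) :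
    ∃ F : Set (Σ s, X s), F.Finite ∧ ∃ t' : Term L (Within F) s,
      t'.rename (fun _ z => z.1) = t := by
  induction t with
  | @var s b => exact ⟨{⟨s, b⟩}, Set.finite_singleton _, .var ⟨b, rfl⟩, rfl⟩
  | func g ts ih =>
    choose F hF t' ht using ih
    refine ⟨⋃ i, F i, Set.finite_iUnion hF,
      .func g fun i => (t' i).rename fun _ z => ⟨z.1, Set.mem_iUnion_of_mem i z.2⟩, ?_⟩
    simp only [Term.rename]
    congr 1
    funext i
    rw [← ht i]
    have : ∀ {s : L.Sorts} (t : Term L (Within (F i)) s),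
        (t.rename fun _ z => (⟨z.1, Set.mem_iUnion_of_mem i z.2⟩ : Within (⋃ i, F i) _)).rename
          (fun _ z => z.1) = t.rename fun _ z => z.1 := by
      intro s t
      induction t with
      | var b => rfl
      | func g ts ih => simp only [Term.rename, ih]
    exact this (t' i)

/-- Allowing every `F'` above `F` lets the supports of several subterms or subformulas be enlarged
to their union. -/
theorem Term.exists_finite_support_realize {X : L.Sorts → Type x} {s : L.Sorts}
    (t : Term L X s) :
    ∃ F : Set (Σ s, X s), F.Finite ∧ ∀ F', F ⊆ F' → ∃ t' : Term L (Within F') s,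
      ∀ a : Tuple M X, t'.realize (fun s z => a s z.1) = t.realize a := by
  obtain ⟨F, hF, t', rfl⟩ := t.exists_finite_support
  refine ⟨F, hF, fun F' h => ⟨t'.rename fun _ z => ⟨z.1, h z.2⟩, fun a => ?_⟩⟩
  simp only [Term.realize_rename]

/-- A formula is equivalent to one in finitely many of its free variables. -/
theorem Formula.exists_finite_support {X : L.Sorts → Type x} (φ : Formula L X) :
    ∃ F : Set (Σ s, X s), F.Finite ∧ ∀ F', F ⊆ F' → ∃ ψ : Formula L (Within F'),
      ∀ a : Tuple M X, ψ.Realize (fun s z => a s z.1) ↔ φ.Realize a := by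
  induction φ with
  | falsum => exact ⟨∅, Set.finite_empty, fun F' _ => ⟨.falsum, fun a => Iff.rfl⟩⟩
  | equal t₁ t₂ =>
    obtain ⟨F₁, h₁, H₁⟩ := t₁.exists_finite_support_realize (M := M)
    obtain ⟨F₂, h₂, H₂⟩ := t₂.exists_finite_support_realize (M := M)
    refine ⟨F₁ ∪ F₂, h₁.union h₂, fun F' h => ?_⟩
    obtain ⟨t₁', e₁⟩ := H₁ F' (Set.subset_union_left.trans h)
    obtain ⟨t₂', e₂⟩ := H₂ F' (Set.subset_union_right.trans h)
    exact ⟨.equal t₁' t₂', fun a => by simp only [Formula.Realize, e₁, e₂]⟩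
  | rel R ts =>
    choose F hF H using fun i => (ts i).exists_finite_support_realize (M := M)
    refine ⟨⋃ i, F i, Set.finite_iUnion hF, fun F' h => ?_⟩
    choose t' ht using fun i => H i F' ((Set.subset_iUnion F i).trans h)
    exact ⟨.rel R t', fun a => by simp only [Formula.Realize, ht]⟩
  | imp φ₁ φ₂ ih₁ ih₂ =>
    obtain ⟨F₁, h₁, H₁⟩ := ih₁
    obtain ⟨F₂, h₂, H₂⟩ := ih₂
    refine ⟨F₁ ∪ F₂, h₁.union h₂, fun F' h => ?_⟩
    obtain ⟨ψ₁, e₁⟩ := H₁ F' (Set.subset_union_left.trans h)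
    obtain ⟨ψ₂, e₂⟩ := H₂ F' (Set.subset_union_right.trans h)
    exact ⟨.imp ψ₁ ψ₂, fun a => by simp only [Formula.Realize, e₁, e₂]⟩
  | @all X s φ ih =>
    obtain ⟨F, hF, H⟩ := ih
    let ι : (Σ t, X t) → Σ t, Extend X s t := fun e => ⟨e.1, .old e.2⟩
    have hι : Function.Injective ι := by
      rintro ⟨t, a⟩ ⟨t', a'⟩ h
      simp only [ι, Sigma.mk.injEq] at h
      obtain ⟨rfl, h⟩ := h
      simpa using h
    refine ⟨ι ⁻¹' F, hF.preimage hι.injOn, fun F' h => ?_⟩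
    -- The bound variable belongs to `F''` vacuously, whether or not it occurs in `F`.
    let F'' : Set (Σ t, Extend X s t) := {e | ∀ b, e.2 = .old b → (⟨e.1, b⟩ : Σ t, X t) ∈ F'}
    have hF'' : F ⊆ F'' := by
      rintro ⟨t, z⟩ hz b hb
      exact h ((congrArg (fun z => (⟨t, z⟩ : Σ t, Extend X s t) ∈ F) hb).mp hz)
    obtain ⟨ψ, e⟩ := H F'' hF''
    let f : ∀ t, Within F'' t → Extend (Within F') s t := fun t z =>
      match z with
      | ⟨.old b, hb⟩ => .old ⟨b, hb b rfl⟩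
      | ⟨.new h, _⟩ => .new h
    refine ⟨.all s (ψ.rename f), fun a => ?_⟩
    simp only [Formula.Realize, Formula.realize_rename]
    refine forall_congr' fun m => ?_
    rw [← e]
    refine iff_of_eq (congrArg _ ?_)
    funext t z
    obtain ⟨z, hz⟩ := z
    cases z with
    | old b => rfl
    | new h => rfl

/-- The predicate `P` is definable with parameters from `C`. -/
def Dfn (C : Set (Σ s, M s)) {X : L.Sorts → Type x} (P : Tuple M X → Prop) : Prop :=
  ∃ φ : ParamFormula C X, ∀ a, φ.Holds a ↔ P a

/-- The concatenation of two tuples. -/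
abbrev Tuple.join {S : Type u} {N : S → Type w} {X : S → Type x} {Y : S → Type y}
    (a : Tuple N X) (b : Tuple N Y) : Tuple N (fun s => X s ⊕ Y s) :=
  fun s => Sum.elim (a s) (b s)

/-- The binary predicate `R` is definable with parameters from `C`. -/
abbrev Dfn₂ (C : Set (Σ s, M s)) {X : L.Sorts → Type x} {Y : L.Sorts → Type y}
    (R : Tuple M X → Tuple M Y → Prop) : Prop :=
  Dfn C fun c : Tuple M (fun s => X s ⊕ Y s) => R (fun s z => c s (.inl z)) fun s z => c s (.inr z)

variable {C D : Set (Σ s, M s)} {X : L.Sorts → Type x} {Y : L.Sorts → Type y}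
  {P Q : Tuple M X → Prop}

theorem ParamFormula.holds_iff (φ ψ : ParamFormula C X) (a : Tuple M X) :
    ParamFormula.Holds (Formula.iff φ ψ) a ↔ (φ.Holds a ↔ ψ.Holds a) := by
  simp only [ParamFormula.Holds, Formula.iff, Formula.not, Formula.Realize]
  tauto

theorem ParamFormula.holds_lift (h : C ⊆ D) (φ : ParamFormula C X) (a : Tuple M X) :
    (φ.lift h).Holds a ↔ φ.Holds a := by
  simp only [ParamFormula.Holds, ParamFormula.lift, Formula.realize_rename]
  refine iff_of_eq (congrArg _ ?_)
  funext s z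
  cases z <;> rfl

theorem ParamFormula.holds_plug (φ : ParamFormula C fun s => X s ⊕ Y s) (a : Tuple M X)
    (b : Tuple M Y) : (φ.plug b).Holds a ↔ φ.Holds (a.join b) := by
  simp only [ParamFormula.Holds, ParamFormula.plug, Formula.realize_rename]
  refine iff_of_eq (congrArg _ ?_)
  funext s z
  rcases z with (z | z) | z <;> rfl

theorem Dfn.holds (φ : ParamFormula C X) : Dfn C φ.Holds := ⟨φ, fun _ => Iff.rfl⟩

theorem Dfn.congr (h : Dfn C P) (e : ∀ a, P a ↔ Q a) : Dfn C Q := by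
  obtain ⟨φ, hφ⟩ := h
  exact ⟨φ, fun a => (hφ a).trans (e a)⟩

theorem Dfn.imp (hP : Dfn C P) (hQ : Dfn C Q) : Dfn C fun a => P a → Q a := by
  obtain ⟨φ, hφ⟩ := hP
  obtain ⟨ψ, hψ⟩ := hQ
  exact ⟨.imp φ ψ, fun a => imp_congr (hφ a) (hψ a)⟩

theorem Dfn.false : Dfn C fun _ : Tuple M X => False := ⟨.falsum, fun _ => Iff.rfl⟩

theorem Dfn.not (hP : Dfn C P) : Dfn C fun a => ¬ P a := hP.imp .false

theorem Dfn.const (p : Prop) : Dfn C fun _ : Tuple M X => p := by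
  by_cases h : p
  · exact (Dfn.not .false).congr fun _ => by simp [h]
  · exact Dfn.false.congr fun _ => by simp [h]

theorem Dfn.and (hP : Dfn C P) (hQ : Dfn C Q) : Dfn C fun a => P a ∧ Q a :=
  (hP.imp hQ.not).not.congr fun _ => by tauto

theorem Dfn.iff (hP : Dfn C P) (hQ : Dfn C Q) : Dfn C fun a => P a ↔ Q a :=
  ((hP.imp hQ).and (hQ.imp hP)).congr fun _ => by tauto

theorem Dfn.forall_mem_finset {ι : Type*} (G : Finset ι) {P : ι → Tuple M X → Prop}
    (h : ∀ i ∈ G, Dfn C (P i)) : Dfn C fun a => ∀ i ∈ G, P i a := by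
  classical
  induction G using Finset.induction_on with
  | empty => exact (Dfn.const True).congr fun _ => by simp
  | insert i G _ ih =>
    refine ((h i (by simp)).and (ih fun j hj => h j (by simp [hj]))).congr fun a => ?_
    simp

/-- Substitution of variables and parameters for variables. -/
theorem Dfn.comp (hP : Dfn C P) (hCD : C ⊆ D) (g : Tuple M Y → Tuple M X)
    (hg : ∀ s z, (∃ z', ∀ a, g a s z = a s z') ∨
      ∃ m, (⟨s, m⟩ : Σ s, M s) ∈ D ∧ ∀ a, g a s z = m) :
    Dfn D fun a => P (g a) := by
  obtain ⟨φ, hφ⟩ := hP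
  have : ∀ s z, ∃ z' : Y s ⊕ Params D s, ∀ a, g a s z = Sum.elim (a s) (fun m => m.1) z' := by
    intro s z
    obtain ⟨z', h⟩ | ⟨m, hm, h⟩ := hg s z
    · exact ⟨.inl z', h⟩
    · exact ⟨.inr ⟨m, hm⟩, h⟩
  choose f hf using this
  refine ⟨Formula.rename (fun s => Sum.elim (f s) fun m => .inr ⟨m.1, hCD m.2⟩) φ,
    fun a => Iff.trans ?_ (hφ _)⟩
  simp only [ParamFormula.Holds, Formula.realize_rename]
  refine iff_of_eq (congrArg _ ?_)
  funext s z
  rcases z with z | z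
  · exact (hf s z a).symm
  · rfl

theorem Dfn.mono (hP : Dfn C P) (hCD : C ⊆ D) : Dfn D P :=
  hP.comp hCD id fun _ z => .inl ⟨z, fun _ => rfl⟩

theorem Dfn₂.apply {R : Tuple M X → Tuple M Y → Prop} (hR : Dfn₂ C R) (hCD : C ⊆ D)
    (b : Tuple M Y) (hb : ∀ s z, (⟨s, b s z⟩ : Σ s, M s) ∈ D) : Dfn D fun a => R a b :=
  Dfn.comp hR hCD (fun a => a.join b) fun s z => by
    rcases z with z | z
    · exact .inl ⟨z, fun _ => rfl⟩
    · exact .inr ⟨b s z, hb s z, fun _ => rfl⟩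

theorem Dfn.exists_one {s : L.Sorts} {P : Tuple M (Extend X s) → Prop} (hP : Dfn C P) :
    Dfn C fun a => ∃ m : M s, P (Tuple.extend a m) := by
  obtain ⟨φ, hφ⟩ := hP.not
  let f : ∀ t, Extend X s t ⊕ Params C t → Extend (fun t => X t ⊕ Params C t) s t := fun t z =>
    match z with
    | .inl (.old b) => .old (.inl b)
    | .inl (.new h) => .new h
    | .inr m => .old (.inr m)
  have : Dfn C fun a => ∀ m : M s, ¬ P (Tuple.extend a m) := by
    refine ⟨.all s (φ.rename f), fun a => ?_⟩
    simp only [ParamFormula.Holds, Formula.Realize, Formula.realize_rename]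
    refine forall_congr' fun m => ?_
    refine Iff.trans ?_ (hφ _)
    refine iff_of_eq (congrArg _ ?_)
    funext t z
    rcases z with (z | z) | z <;> rfl
  exact this.not.congr fun a => by simp

/-- Induction on the finite index type: one coordinate is split off as the new variable of `Extend`
and quantified last. The context `X` therefore has to vary in the induction. -/
theorem Dfn.exists_family {ι : Type y} [Finite ι] :
    ∀ (X : L.Sorts → Type x) (τ : ι → L.Sorts) (R : Tuple M X → (∀ i, M (τ i)) → Prop),
      (Dfn C fun c : Tuple M (fun s => X s ⊕ {i // τ i = s}) =>
        R (fun s z => c s (.inl z)) fun i => c _ (.inr ⟨i, rfl⟩)) →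
      Dfn C fun a => ∃ b, R a b := by
  induction ι using Finite.induction_empty_option with
  | @of_equiv α β e ih =>
    intro X τ R hR
    have := ih X (fun i => τ (e i)) (fun a b => R a fun i => (e.apply_symm_apply i) ▸ b (e.symm i))
      (by
        refine (hR.comp le_rfl (fun c s => Sum.elim (fun z => c s (.inl z))
          fun i => c s (.inr ⟨e.symm i.1, by rw [e.apply_symm_apply]; exact i.2⟩)) ?_).congr ?_
        · rintro s (z | z)
          · exact .inl ⟨_, fun _ => rfl⟩
          · exact .inl ⟨_, fun _ => rfl⟩
        · intro c
          refine iff_of_eq (congrArg _ ?_)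
          funext i
          simp only [Sum.elim_inr]
          have : ∀ (j : β) (h : j = i), c (τ i) (.inr ⟨e.symm i, by rw [e.apply_symm_apply]⟩) =
            h ▸ c (τ j) (.inr ⟨e.symm i, by rw [e.apply_symm_apply, h]⟩) := by
              rintro j rfl; rfl
          exact this _ (e.apply_symm_apply i))
    refine this.congr fun a => ⟨fun ⟨b, hb⟩ => ⟨_, hb⟩, fun ⟨b, hb⟩ => ⟨fun i => b (e i), ?_⟩⟩
    convert hb using 2 with i
    have : ∀ (j : β) (h : j = i), h ▸ b j = b i := by rintro j rfl; rfl
    exact this _ _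
  | h_empty =>
    intro X τ R hR
    refine (hR.comp le_rfl (fun a s => Sum.elim (a s) fun i => i.1.elim) ?_).congr fun a => ?_
    · rintro s (z | z)
      · exact .inl ⟨z, fun _ => rfl⟩
      · exact z.1.elim
    · constructor
      · exact fun h => ⟨_, h⟩
      · rintro ⟨b, h⟩
        obtain rfl : b = fun i => i.elim := funext fun i => i.elim
        exact h
  | @h_option α _ ih =>
    intro X τ R hR
    have := ih (Extend X (τ none)) (fun i => τ (some i))
      (fun a b => R (fun s z => a s (.old z)) fun i =>
        match i with
        | none => a _ (.new rfl)
        | some i => b i)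
      (by
        refine (hR.comp le_rfl (fun c s => Sum.elim (fun z => c s (.inl (.old z))) fun i =>
          match i with
          | ⟨none, h⟩ => c s (.inl (.new h))
          | ⟨some i, h⟩ => c s (.inr ⟨i, h⟩)) ?_).congr fun c => ?_
        · rintro s (z | ⟨_ | i, h⟩)
          · exact .inl ⟨_, fun _ => rfl⟩
          · exact .inl ⟨_, fun _ => rfl⟩
          · exact .inl ⟨_, fun _ => rfl⟩
        · refine iff_of_eq (congrArg _ ?_)
          funext i
          cases i <;> rfl)
    refine this.exists_one.congr fun a => ⟨fun ⟨m, b, h⟩ => ⟨_, h⟩, fun ⟨b, h⟩ =>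
      ⟨b none, fun i => b (some i), ?_⟩⟩
    refine (iff_of_eq (congrArg (R a) (funext fun i => ?_))).2 h
    cases i <;> rfl

/-- Definable predicates are closed under quantification over finite tuples. -/
theorem Dfn₂.exists [Finite (Σ s, Y s)] {R : Tuple M X → Tuple M Y → Prop} (hR : Dfn₂ C R) :
    Dfn C fun a => ∃ b, R a b := by
  refine (Dfn.exists_family (ι := Σ s, Y s) X (fun i => i.1)
    (fun a b => R a fun s z => b ⟨s, z⟩) ?_).congr fun a =>
      ⟨fun ⟨b, h⟩ => ⟨_, h⟩, fun ⟨b, h⟩ => ⟨fun i => b i.1 i.2, h⟩⟩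
  exact Dfn.comp hR le_rfl (Y := fun s => X s ⊕ {i : Σ s, Y s // i.1 = s})
    (fun c s => Sum.elim (fun z => c s (.inl z))
      fun z => c s (.inr ⟨⟨s, z⟩, rfl⟩)) fun s z => by
      rcases z with z | z
      · exact .inl ⟨_, fun _ => rfl⟩
      · exact .inl ⟨_, fun _ => rfl⟩

/-- The parameters from `D` in a definable predicate can be replaced by variables. -/
theorem Dfn.exists_eq_apply (hP : Dfn (C ∪ D) P) :
    ∃ (Y : L.Sorts → Type) (_ : Finite (Σ s, Y s)) (R : Tuple M X → Tuple M Y → Prop)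
      (b : Tuple M Y), Dfn₂ C R ∧ (∀ s z, (⟨s, b s z⟩ : Σ s, M s) ∈ D) ∧ ∀ a, P a ↔ R a b := by
  classical
  obtain ⟨φ, hφ⟩ := hP
  obtain ⟨F, hF, H⟩ := Formula.exists_finite_support (M := M) φ
  obtain ⟨ψ, hψ⟩ := H F le_rfl
  let Y₀ : L.Sorts → Type w := fun s =>
    {m : M s // ∃ h : (⟨s, m⟩ : Σ s, M s) ∈ C ∪ D,
      (⟨s, .inr ⟨m, h⟩⟩ : Σ s, X s ⊕ Params (C ∪ D) s) ∈ F ∧ (⟨s, m⟩ : Σ s, M s) ∈ D}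
  have hY₀ : Finite (Σ s, Y₀ s) := by
    have := hF.to_subtype
    refine Finite.of_injective (β := F)
      (fun e => ⟨⟨e.1, .inr ⟨e.2.1, e.2.2.choose⟩⟩, e.2.2.choose_spec.1⟩) ?_
    rintro ⟨s, m, hm⟩ ⟨s', m', hm'⟩ h
    simp only [Subtype.mk.injEq, Sigma.mk.injEq] at h
    obtain ⟨rfl, h⟩ := h
    simp only [heq_eq_eq, Sum.inr.injEq, Subtype.mk.injEq] at h
    subst h
    rfl
  have hY₀' : ∀ s, Finite (Y₀ s) := fun s =>
    Finite.of_injective (fun z => (⟨s, z⟩ : Σ s, Y₀ s)) sigma_mk_injective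
  -- `Y₀` lives in the universe of `M`; numbering its elements gives a context in `Type`.
  let e : ∀ s, Y₀ s ≃ Fin (Nat.card (Y₀ s)) := fun s => Finite.equivFin _
  let f : ∀ s, Within F s → (X s ⊕ Fin (Nat.card (Y₀ s))) ⊕ Params C s := fun s z =>
    match z with
    | ⟨.inl z, _⟩ => .inl (.inl z)
    | ⟨.inr m, hm⟩ =>
      if h : (⟨s, m.1⟩ : Σ s, M s) ∈ D then .inl (.inr (e s ⟨m.1, m.2, hm, h⟩))
      else .inr ⟨m.1, m.2.resolve_right h⟩
  refine ⟨fun s => Fin (Nat.card (Y₀ s)), Finite.of_equiv _ (Equiv.sigmaCongrRight e),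
    fun a b => ParamFormula.Holds (C := C) (ψ.rename f) (a.join b),
    fun s z => ((e s).symm z).1, ?_, fun s z => ((e s).symm z).2.choose_spec.2, fun a => ?_⟩
  · refine ⟨ψ.rename f, fun c => iff_of_eq (congrArg _ ?_)⟩
    funext s z
    cases z <;> rfl
  · rw [← hφ]
    simp only [ParamFormula.Holds, Formula.realize_rename]
    rw [← hψ]
    refine iff_of_eq (congrArg _ ?_)
    funext s z
    rcases z with ⟨z | m, hz⟩
    · rfl
    · by_cases h : (⟨s, m.1⟩ : Σ s, M s) ∈ D
      · simp [f, h]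
      · simp [f, h]

theorem tp_eq_iff {a b : Tuple M X} :
    tp C a = tp C b ↔ ∀ P : Tuple M X → Prop, Dfn C P → (P a ↔ P b) := by
  constructor
  · rintro h P ⟨φ, hφ⟩
    rw [← hφ, ← hφ]
    exact Set.ext_iff.1 h φ
  · exact fun h => Set.ext fun φ => h _ (Dfn.holds φ)

end Definability

/-! ### Saturation, homogeneity, invariance and Morley sequences -/

section Saturation

variable {L : Language.{u, v}} {M : L.Sorts → Type w}

/-- The set of entries of a tuple. -/
def entries {X : L.Sorts → Type x} (a : Tuple M X) : Set (Σ s, M s) :=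
  {e | ∃ k : X e.1, a e.1 k = e.2}

theorem mem_entries {X : L.Sorts → Type x} (a : Tuple M X) (s : L.Sorts) (k : X s) :
    (⟨s, a s k⟩ : Σ s, M s) ∈ entries a := ⟨k, rfl⟩

theorem countable_entries {X : L.Sorts → Type x} [Finite (Σ s, X s)] (a : Tuple M X) :
    (entries a).Countable := by
  refine (Set.countable_range fun k : Σ s, X s => (⟨k.1, a k.1 k.2⟩ : Σ s, M s)).mono ?_
  rintro ⟨s, m⟩ ⟨k, hk⟩
  exact ⟨⟨s, k⟩, congrArg (Sigma.mk s) hk⟩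

theorem mk_union_lt_of_countable {α : Type u} (hα : ℵ₀ < #α) {C D : Set α} (hC : #C < #α)
    (hD : D.Countable) : #(C ∪ D : Set α) < #α :=
  (mk_union_le C D).trans_lt <| add_lt_of_lt hα.le hC <|
    (le_aleph0_iff_set_countable.2 hD).trans_lt hα

theorem mem_entriesBelow {X : L.Sorts → Type} {I : Type y} [LinearOrder I] (a : I → Tuple M X)
    {i j : I} (h : j < i) (s : L.Sorts) (k : X s) :
    (⟨s, a j s k⟩ : Σ s, M s) ∈ entriesBelow a i := ⟨j, h, k, rfl⟩

theorem entriesBelow_subset_iff {X : L.Sorts → Type} {I : Type y} [LinearOrder I]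
    {a : I → Tuple M X} {i : I} {C : Set (Σ s, M s)} :
    entriesBelow a i ⊆ C ↔ ∀ j < i, entries (a j) ⊆ C := by
  constructor
  · rintro h j hj e ⟨k, hk⟩
    exact h ⟨j, hj, k, hk⟩
  · rintro h e ⟨j, hj, k, hk⟩
    exact h j hj ⟨k, hk⟩

theorem entriesBelow_succ {X : L.Sorts → Type} (a : ℕ → Tuple M X) (i : ℕ) :
    entriesBelow a (i + 1) = entriesBelow a i ∪ entries (a i) := by
  apply Set.Subset.antisymm
  · refine entriesBelow_subset_iff.2 fun j hj => ?_
    obtain h | rfl := Nat.lt_succ_iff_lt_or_eq.1 hj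
    · exact (entriesBelow_subset_iff.1 le_rfl j h).trans Set.subset_union_left
    · exact Set.subset_union_right
  · exact Set.union_subset
      (entriesBelow_subset_iff.2 fun j hj => entriesBelow_subset_iff.1 le_rfl j (by omega))
      (entriesBelow_subset_iff.1 le_rfl i (by omega))

theorem concat_succ {X : L.Sorts → Type} (a : ℕ → Tuple M X) {k : ℕ} (f : Fin (k + 1) → ℕ) :
    concat a f = fun s z => Fin.lastCases (motive := fun _ => M s) (a (f (Fin.last k)) s z.2)
      (fun i => concat a (fun i => f (Fin.castSucc i)) s (i, z.2)) z.1 := by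
  funext s ⟨i, z⟩
  cases i using Fin.lastCases <;> simp [concat]

variable [Struct L M] {C D A B : Set (Σ s, M s)} {X Y : L.Sorts → Type}

/-- The tuple `a` satisfies every `C`-definable predicate that holds eventually along `V`. When `V`
is an ultrafilter, this says that `a` realizes the restriction to `C` of the global type of `V`. -/
def RealizesOver (V : Filter (Tuple M X)) (C : Set (Σ s, M s)) (a : Tuple M X) : Prop :=
  ∀ P, Dfn C P → (∀ᶠ x in V, P x) → P a

theorem RealizesOver.mono {V : Filter (Tuple M X)} {a : Tuple M X} (h : RealizesOver V D a)
    (hCD : C ⊆ D) : RealizesOver V C a := fun P hP => h P (hP.mono hCD)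

theorem RealizesOver.eventually_iff {V : Ultrafilter (Tuple M X)} {a : Tuple M X}
    (h : RealizesOver V C a) {P : Tuple M X → Prop} (hP : Dfn C P) :
    (∀ᶠ x in (V : Filter _), P x) ↔ P a := by
  refine ⟨h P hP, fun hPa => ?_⟩
  by_contra hn
  exact h _ hP.not (Ultrafilter.eventually_not.2 hn) hPa

theorem RealizesOver.tp_eq {V : Ultrafilter (Tuple M X)} {a b : Tuple M X}
    (ha : RealizesOver V C a) (hb : RealizesOver V C b) : tp C a = tp C b :=
  tp_eq_iff.2 fun _ hP => (ha.eventually_iff hP).symm.trans (hb.eventually_iff hP)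

/-- The `C`-formulas that hold almost everywhere for an ultrafilter refining `V` form a complete
type over `C`. -/
theorem IsSaturated.exists_realizesOver [Finite (Σ s, X s)] (hM : IsSaturated L M)
    (hC : #C < #(Σ s, M s))
    (V : Filter (Tuple M X)) [V.NeBot] : ∃ a, RealizesOver V C a := by
  let W := Ultrafilter.of V
  let q : Set (ParamFormula C X) := {φ | ∀ᶠ x in (W : Filter _), φ.Holds x}
  obtain ⟨a, ha⟩ := hM C hC X q
    { finitely_satisfiable := fun F hF hfin =>
        ((Filter.eventually_all_finite (l := (W : Filter (Tuple M X)))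
          (p := fun (φ : ParamFormula C X) x => φ.Holds x) hfin).2 fun _ h => hF h).exists
      complete := fun φ => Ultrafilter.em W φ.Holds }
  refine ⟨a, fun P ⟨φ, hφ⟩ hP => (hφ a).1 (ha φ ?_)⟩
  have hW : ∀ᶠ x in (W : Filter _), P x := Ultrafilter.of_le V hP
  exact hW.mono fun x => (hφ x).2

theorem IsSaturated.exists_forall [Finite (Σ s, X s)] (hM : IsSaturated L M)
    (hC : #C < #(Σ s, M s)) {ι : Type*}
    (P : ι → Tuple M X → Prop) (hP : ∀ i, Dfn C (P i))
    (h : ∀ G : Finset ι, ∃ a, ∀ i ∈ G, P i a) : ∃ a, ∀ i, P i a := by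
  classical
  let V := Filter.generate (Set.range fun i => {a | P i a})
  have : V.NeBot := by
    refine Filter.generate_neBot_iff.2 fun t ht hfin => ?_
    lift t to Finset (Set (Tuple M X)) using hfin
    rw [← Set.image_univ] at ht
    obtain ⟨G, -, rfl⟩ := Finset.subset_set_image_iff.1 ht
    obtain ⟨a, ha⟩ := h G
    exact ⟨a, by simpa using ha⟩
  obtain ⟨a, ha⟩ := hM.exists_realizesOver hC V
  exact ⟨a, fun i => ha _ (hP i) (Filter.mem_generate_of_mem ⟨i, rfl⟩)⟩

/-- Homogeneity. -/
theorem IsSaturated.exists_tp_join_eq [Finite (Σ s, Y s)] (hM : IsSaturated L M) {a a' : Tuple M X}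
    (h : tp C a = tp C a') (hC : #(C ∪ entries a' : Set (Σ s, M s)) < #(Σ s, M s))
    (b : Tuple M Y) : ∃ b', tp C (a.join b) = tp C (a'.join b') := by
  let ι := {R : Tuple M X → Tuple M Y → Prop // Dfn₂ C R ∧ R a b}
  obtain ⟨b', hb'⟩ := hM.exists_forall hC (fun R : ι => R.1 a')
    (fun R => by
      refine Dfn.comp R.2.1 Set.subset_union_left (fun y => a'.join y) fun s z => ?_
      rcases z with z | z
      · exact .inr ⟨a' s z, .inr (mem_entries a' s z), fun _ => rfl⟩
      · exact .inl ⟨z, fun _ => rfl⟩)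
    (fun G => by
      -- Solvability of finitely many conditions on `b` is a `C`-definable property of `a`, so it
      -- passes to `a'`.
      have : Dfn C fun a => ∃ b, ∀ R ∈ G, R.1 a b :=
        Dfn₂.exists (Dfn.forall_mem_finset G fun R _ => R.2.1)
      exact (tp_eq_iff.1 h _ this).1 ⟨b, fun R _ => R.2.2⟩)
  have key : ∀ P : Tuple M (fun s => X s ⊕ Y s) → Prop, Dfn C P →
      P (a.join b) → P (a'.join b') := fun P hP hab =>
    hb' ⟨fun a b => P (a.join b), hP.congr fun c => iff_of_eq (congrArg P
      (funext fun s => funext fun z => by cases z <;> rfl)), hab⟩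
  exact ⟨b', tp_eq_iff.2 fun P hP => ⟨key P hP, not_imp_not.1 (key _ hP.not)⟩⟩

theorem tp_join_eq_iff {X : L.Sorts → Type x} {Y : L.Sorts → Type y} {a a' : Tuple M X}
    {b b' : Tuple M Y} : tp C (a.join b) = tp C (a'.join b') ↔
      ∀ R : Tuple M X → Tuple M Y → Prop, Dfn₂ C R → (R a b ↔ R a' b') := by
  rw [tp_eq_iff]
  refine ⟨fun h R hR => h _ hR, fun h P hP => h (fun a b => P (a.join b)) ?_⟩
  exact hP.congr fun c => iff_of_eq (congrArg P
      (funext fun s => funext fun z => by cases z <;> rfl))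

/-- The global type of `V` is `A`-invariant. -/
def InvariantOver (V : Filter (Tuple M X)) (A : Set (Σ s, M s)) : Prop :=
  ∀ (Y : L.Sorts → Type) [Finite (Σ s, Y s)] (R : Tuple M X → Tuple M Y → Prop), Dfn₂ A R →
    ∀ b₁ b₂, tp A b₁ = tp A b₂ → (∀ᶠ x in V, R x b₁) → ∀ᶠ x in V, R x b₂

/-- The parameters `e` from `B` are moved into the tuple: equality of types of `b₁`, `b₂` over `B`
gives equality of types of `b₁e`, `b₂e` over `A`. -/
theorem InvariantOver.mono {V : Filter (Tuple M X)} (h : InvariantOver V A) (hAB : A ⊆ B) :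
    InvariantOver V B := by
  intro Y _ R hR b₁ b₂ hb hV
  rw [← Set.union_eq_self_of_subset_left hAB] at hR
  obtain ⟨Z, _, Q, e, hQ, he, hRQ⟩ := hR.exists_eq_apply
  have hR' : ∀ x b, R x b ↔ Q (x.join b) e := fun x b => hRQ (x.join b)
  simp only [hR'] at hV ⊢
  have : Finite (Σ s, Y s ⊕ Z s) := Finite.of_equiv _ (Equiv.sigmaSumDistrib Y Z).symm
  refine h (fun s => Y s ⊕ Z s)
    (fun x c => Q (x.join fun s z => c s (.inl z)) fun s z => c s (.inr z))
    ?_ (b₁.join e) (b₂.join e) ?_ hV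
  · refine (Dfn.comp hQ le_rfl (fun (c : Tuple M fun s => X s ⊕ (Y s ⊕ Z s)) s =>
      Sum.elim (Sum.elim (fun z => c s (.inl z)) fun z => c s (.inr (.inl z)))
        fun z => c s (.inr (.inr z))) ?_).congr fun c => ?_
    · rintro s ((z | z) | z)
      · exact .inl ⟨_, fun _ => rfl⟩
      · exact .inl ⟨_, fun _ => rfl⟩
      · exact .inl ⟨_, fun _ => rfl⟩
    · refine iff_of_eq (congrFun (congrArg Q ?_) _)
      funext s z
      cases z <;> rfl
  · refine tp_join_eq_iff.2 fun S hS => ?_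
    exact tp_eq_iff.1 hb _ (hS.apply hAB e he)

/-- `(a i ∣ i < ω)` is a Morley sequence over `A` in the global type of `V`. -/
def MorleyOver (V : Filter (Tuple M X)) (A : Set (Σ s, M s)) (a : ℕ → Tuple M X) : Prop :=
  ∀ i, RealizesOver V (A ∪ entriesBelow a i) (a i)

/-- Whether `P` holds of `k + 1` terms is decided by whether `V` contains a predicate with the first
`k` terms as parameters. By invariance this depends only on the type of those `k` terms over `A`, so
induction applies. -/
theorem MorleyOver.tp_concat_eq [Finite (Σ s, X s)] {V : Ultrafilter (Tuple M X)}
    (hV : InvariantOver (V : Filter (Tuple M X)) A)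
    {a a' : ℕ → Tuple M X} (ha : MorleyOver (V : Filter (Tuple M X)) A a)
    (ha' : MorleyOver (V : Filter (Tuple M X)) A a') :
    ∀ {k : ℕ} {f g : Fin k → ℕ}, StrictMono f → StrictMono g →
      tp A (concat a f) = tp A (concat a' g)
  | 0, f, g, _, _ => congrArg (tp A) (funext fun s => funext fun z => z.1.elim0)
  | k + 1, f, g, hf, hg => by
    refine tp_eq_iff.2 fun P hP => ?_
    let R : Tuple M X → Tuple M (fun s => Fin k × X s) → Prop := fun x y => P fun s z =>
      Fin.lastCases (motive := fun _ => M s) (x s z.2) (fun i => y s (i, z.2)) z.1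
    have hR : Dfn₂ A R := by
      refine Dfn.comp hP le_rfl _ fun s z => ?_
      obtain ⟨i, z⟩ := z
      cases i using Fin.lastCases with
      | last => exact .inl ⟨.inl z, fun _ => by simp⟩
      | cast i => exact .inl ⟨.inr (i, z), fun _ => by simp⟩
    have key : ∀ {a : ℕ → Tuple M X}, MorleyOver (V : Filter (Tuple M X)) A a →
        ∀ {f : Fin (k + 1) → ℕ}, StrictMono f →
        ((∀ᶠ x in (V : Filter _), R x (concat a fun i => f (Fin.castSucc i))) ↔
          P (concat a f)) := by
      intro a ha f hf
      rw [concat_succ]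
      refine (ha (f (Fin.last k))).eventually_iff (hR.apply Set.subset_union_left _ ?_)
      rintro s ⟨i, z⟩
      exact .inr (mem_entriesBelow a (hf (Fin.castSucc_lt_last i)) s z)
    have : Finite (Σ s, Fin k × X s) :=
      Finite.of_injective (β := Fin k × Σ s, X s) (fun e => (e.2.1, ⟨e.1, e.2.2⟩)) (by
        rintro ⟨s, i, z⟩ ⟨s', i', z'⟩ h
        simp only [Prod.mk.injEq, Sigma.mk.injEq] at h
        obtain ⟨rfl, rfl, h⟩ := h
        rw [eq_of_heq h])
    have ih := ha.tp_concat_eq hV ha' (hf.comp Fin.strictMono_castSucc)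
      (hg.comp Fin.strictMono_castSucc)
    rw [← key ha hf, ← key ha' hg]
    exact ⟨hV _ R hR _ _ ih, hV _ R hR _ _ ih.symm⟩

theorem IsIndiscernible.of_morleyOver [Finite (Σ s, X s)] {V : Ultrafilter (Tuple M X)}
    (hV : InvariantOver (V : Filter (Tuple M X)) A) {a : ℕ → Tuple M X}
    (ha : MorleyOver (V : Filter (Tuple M X)) A a) :
    IsIndiscernible A a :=
  fun _ _ _ hf hg => ha.tp_concat_eq hV ha hf hg

theorem IsIndiscernible.mono {a : ℕ → Tuple M X} (ha : IsIndiscernible B a) (hAB : A ⊆ B) :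
    IsIndiscernible A a := fun k f g hf hg =>
  tp_eq_iff.2 fun P hP => tp_eq_iff.1 (ha k f g hf hg) P (hP.mono hAB)

theorem IsIndiscernible.comp {a : ℕ → Tuple M X} (ha : IsIndiscernible A a) {r : ℕ → ℕ}
    (hr : StrictMono r) : IsIndiscernible A fun n => a (r n) :=
  fun k f g hf hg => ha k (fun i => r (f i)) (fun i => r (g i)) (hr.comp hf) (hr.comp hg)

theorem exists_morleyOver [Finite (Σ s, X s)] (hM : IsSaturated L M) (hM' : ℵ₀ < #(Σ s, M s))
    (hC : #C < #(Σ s, M s)) (V : Filter (Tuple M X)) [V.NeBot] : ∃ a, MorleyOver V C a := by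
  let 𝒮 := {D : Set (Σ s, M s) // #D < #(Σ s, M s)}
  choose f hf using fun D : 𝒮 => hM.exists_realizesOver D.2 V
  -- The small set `D n` collects `C` and all terms chosen before stage `n`.
  let D : ℕ → 𝒮 := fun n => Nat.rec ⟨C, hC⟩
    (fun _ D => ⟨D.1 ∪ entries (f D), mk_union_lt_of_countable hM' D.2 (countable_entries _)⟩) n
  have hD : ∀ n, C ∪ entriesBelow (fun n => f (D n)) n ⊆ (D n).1 := by
    intro n
    induction n with
    | zero =>
      exact Set.union_subset le_rfl (entriesBelow_subset_iff.2 fun j hj => absurd hj (by simp))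
    | succ n ih =>
      rw [entriesBelow_succ, ← Set.union_assoc]
      exact Set.union_subset_union_left _ ih
  exact ⟨fun n => f (D n), fun n => (hf (D n)).mono (hD n)⟩

end Saturation

/-! ### From a failure of the one-step property to a failure of NIP -/

section OrderTrivial

variable {L : Language.{u, v}} {M : L.Sorts → Type w} [Struct L M] {A B : Set (Σ s, M s)}
  {X : L.Sorts → Type}

/-- Coheirs are invariant: for `x k` with entries in `A`, the condition `R (x k) b` is `A`-definable
in `b`. -/
theorem invariantOver_map {x : ℕ → Tuple M X} (V : Filter ℕ) (hA : ∀ k, entries (x k) ⊆ A) :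
    InvariantOver (V.map x) A := by
  intro Y _ R hR b₁ b₂ hb h
  refine Filter.eventually_map.2 ((Filter.eventually_map.1 h).mono fun k hk => ?_)
  refine (tp_eq_iff.1 hb (fun b => R (x k) b) ?_).1 hk
  refine Dfn.comp hR le_rfl (fun b => (x k).join b) fun s z => ?_
  rcases z with z | z
  · exact .inr ⟨_, hA k (mem_entries _ s z), fun _ => rfl⟩
  · exact .inl ⟨z, fun _ => rfl⟩

/-- If `P` and its negation both held infinitely often, choosing terms alternately would give a
subsequence on which `P` alternates. -/
theorem eventually_of_frequently_of_not_alternating {c : ℕ → Tuple M X}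
    (hN : ∀ r : ℕ → ℕ, StrictMono r → ∀ P : Tuple M X → Prop, Dfn Set.univ P →
      ¬ ∀ n, P (c (r n)) ↔ Even n)
    {P : Tuple M X → Prop} (hP : Dfn Set.univ P) (h : ∃ᶠ n in Filter.atTop, P (c n)) :
    ∀ᶠ n in Filter.atTop, P (c n) := by
  by_contra hn
  obtain ⟨r, hr, hrP⟩ := Filter.extraction_forall_of_frequently
    (P := fun n k => P (c k) ↔ Even n) (by
      intro n
      by_cases hn' : Even n
      · simpa [hn'] using h
      · simpa [hn'] using Filter.not_eventually.1 hn)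
  exact hN r hr P hP hrP

variable [Finite (Σ s, X s)] {U : Ultrafilter (Tuple M X)}

/-- For a true value, realize `p` over `B ∪ d`. For a false value, move `a₁` along the equality of
types of `a₀` and `d` over `B`; by `A`-invariance the copy still realizes `p` over `A ∪ d`. -/
theorem exists_realizesOver_entries_pattern (hM : IsSaturated L M) (hM' : ℵ₀ < #(Σ s, M s))
    (hU : InvariantOver (U : Filter (Tuple M X)) A) (hAB : A ⊆ B) (hB : #B < #(Σ s, M s))
    {a₀ a₁ : Tuple M X} (h₀ : RealizesOver (U : Filter (Tuple M X)) B a₀)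
    (h₁ : RealizesOver (U : Filter (Tuple M X)) (A ∪ entries a₀) a₁)
    {R : Tuple M X → Tuple M X → Prop} (hR : Dfn₂ B R) (hRU : ∀ᶠ x in (U : Filter _), R x a₀)
    (hRa : ¬ R a₁ a₀) (S : Prop) {d : Tuple M X}
    (hd : RealizesOver (U : Filter (Tuple M X)) B d) :
    ∃ d', RealizesOver (U : Filter (Tuple M X)) (A ∪ entries d) d' ∧ (R d' d ↔ S) := by
  have htp := h₀.tp_eq hd
  have hsmall : #(B ∪ entries d : Set (Σ s, M s)) < #(Σ s, M s) :=
    mk_union_lt_of_countable hM' hB (countable_entries d)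
  by_cases hS : S
  · obtain ⟨d', hd'⟩ := hM.exists_realizesOver hsmall (U : Filter (Tuple M X))
    refine ⟨d', hd'.mono (Set.union_subset_union_left _ hAB), iff_of_true ?_ hS⟩
    exact hd' _ (hR.apply Set.subset_union_left d fun s z => .inr (mem_entries d s z))
      ((hU.mono hAB) X R hR _ _ htp hRU)
  · obtain ⟨d', hd'⟩ := hM.exists_tp_join_eq htp hsmall a₁
    rw [tp_join_eq_iff] at hd'
    refine ⟨d', fun P hP hPU => ?_, iff_of_false ?_ hS⟩
    · obtain ⟨Y, _, T, e, hT, he, hPT⟩ := hP.exists_eq_apply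
      -- The parameters of `P` are coordinates of `d`, selected by `k`; the same coordinates of `a₀`
      -- give the corresponding predicate on the other side.
      choose k hk using he
      have hT' : Dfn₂ A fun x₀ x => T x fun s z => x₀ s (k s z) := by
        refine Dfn.comp hT le_rfl (fun (c : Tuple M fun s => X s ⊕ X s) s =>
          Sum.elim (fun z => c s (.inr z)) fun z => c s (.inl (k s z))) fun s z => ?_
        cases z <;> exact .inl ⟨_, fun _ => rfl⟩
      have hT'' : Dfn₂ A fun x x₀ => T x fun s z => x₀ s (k s z) := by
        refine Dfn.comp hT le_rfl (fun (c : Tuple M fun s => X s ⊕ X s) s =>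
          Sum.elim (fun z => c s (.inl z)) fun z => c s (.inr (k s z))) fun s z => ?_
        cases z <;> exact .inl ⟨_, fun _ => rfl⟩
      have he : (fun s z => d s (k s z)) = e := funext fun s => funext fun z => hk s z
      rw [hPT, ← he]
      refine (hd' (fun x₀ x => T x fun s z => x₀ s (k s z)) (hT'.mono hAB)).1
        (h₁ _ (hT''.apply Set.subset_union_left a₀
        fun s z => .inr (mem_entries a₀ s z)) ?_)
      refine hU X _ hT'' d a₀ ?_ ?_
      · exact tp_eq_iff.2 fun P hP => tp_eq_iff.1 htp.symm P (hP.mono hAB)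
      · rw [he]
        exact hPU.mono fun x => (hPT x).1
    · have hR' : Dfn₂ B fun x₀ x => R x x₀ := by
        refine Dfn.comp hR le_rfl (fun (c : Tuple M fun s => X s ⊕ X s) s =>
          Sum.elim (fun z => c s (.inr z)) fun z => c s (.inl z)) fun s z => ?_
        cases z <;> exact .inl ⟨_, fun _ => rfl⟩
      exact fun h => hRa ((hd' _ hR').2 h)

/-- A sequence in which consecutive terms are Morley over `A`, while the pattern of the relation
`R` on the pairs `(c (2 * i + 1), c (2 * i))` is prescribed. -/
theorem exists_chain_pattern (hM : IsSaturated L M) (hM' : ℵ₀ < #(Σ s, M s))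
    (hU : InvariantOver (U : Filter (Tuple M X)) A) (hAB : A ⊆ B) (hB : #B < #(Σ s, M s))
    {a₀ a₁ : Tuple M X} (h₀ : RealizesOver (U : Filter (Tuple M X)) B a₀)
    (h₁ : RealizesOver (U : Filter (Tuple M X)) (A ∪ entries a₀) a₁)
    {R : Tuple M X → Tuple M X → Prop} (hR : Dfn₂ B R) (hRU : ∀ᶠ x in (U : Filter _), R x a₀)
    (hRa : ¬ R a₁ a₀) (S : ℕ → Prop) :
    ∃ c : ℕ → Tuple M X, RealizesOver (U : Filter (Tuple M X)) A (c 0) ∧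
      (∀ i, RealizesOver (U : Filter (Tuple M X)) (A ∪ entries (c i)) (c (i + 1))) ∧
      ∀ i, R (c (2 * i + 1)) (c (2 * i)) ↔ S i := by
  -- The first entry of each new pair is generic over `B` and the previous term `e`. This links
  -- consecutive pairs and leaves the next value of `R` free.
  have step : ∀ (i : ℕ) (e : Tuple M X), ∃ d : Tuple M X × Tuple M X,
      RealizesOver (U : Filter (Tuple M X)) (B ∪ entries e) d.1 ∧
      RealizesOver (U : Filter (Tuple M X)) (A ∪ entries d.1) d.2 ∧ (R d.2 d.1 ↔ S i) := by
    intro i e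
    obtain ⟨d, hd⟩ := hM.exists_realizesOver
      (mk_union_lt_of_countable hM' hB (countable_entries e)) (U : Filter (Tuple M X))
    obtain ⟨d', h⟩ := exists_realizesOver_entries_pattern hM hM' hU hAB hB h₀ h₁ hR hRU hRa (S i)
      (hd.mono Set.subset_union_left)
    exact ⟨(d, d'), hd, h⟩
  choose g hg₁ hg₂ hgS using step
  let e : ℕ → Tuple M X × Tuple M X := fun n =>
    Nat.rec (g 0 a₀) (fun n d => g (n + 1) d.2) n
  have he : ∀ n, ∃ d, e n = g n d := by
    intro n
    cases n with
    | zero => exact ⟨_, rfl⟩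
    | succ n => exact ⟨_, rfl⟩
  let c : ℕ → Tuple M X := fun n => if n % 2 = 0 then (e (n / 2)).1 else (e (n / 2)).2
  have c_even : ∀ i, c (2 * i) = (e i).1 := fun i => by
    simp only [c]
    rw [if_pos (by omega), show 2 * i / 2 = i by omega]
  have c_odd : ∀ i, c (2 * i + 1) = (e i).2 := fun i => by
    simp only [c]
    rw [if_neg (by omega), show (2 * i + 1) / 2 = i by omega]
  refine ⟨c, (hg₁ 0 a₀).mono (hAB.trans Set.subset_union_left), fun n => ?_, fun i => ?_⟩
  · obtain ⟨i, rfl | rfl⟩ := n.even_or_odd'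
    · rw [c_even, c_odd]
      obtain ⟨d, hd⟩ := he i
      rw [hd]
      exact hg₂ i d
    · rw [c_odd, show 2 * i + 1 + 1 = 2 * (i + 1) by ring, c_even]
      exact (hg₁ (i + 1) (e i).2).mono (Set.union_subset_union_left _ hAB)
  · rw [c_even, c_odd]
    obtain ⟨d, hd⟩ := he i
    rw [hd]
    exact hgS i d

theorem exists_frequently_eq (α : Type*) [Countable α] [Nonempty α] :
    ∃ F : ℕ → α, ∀ a, ∃ᶠ n in Filter.atTop, F n = a := by
  obtain ⟨f, hf⟩ := exists_surjective_nat α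
  refine ⟨fun n => f n.unpair.1, fun a => ?_⟩
  obtain ⟨m, rfl⟩ := hf a
  refine Filter.frequently_atTop.2 fun N => ⟨Nat.pair m N, Nat.right_le_pair m N, ?_⟩
  simp

/-- An independence pattern on pairs from a Morley sequence yields one on single realizations. -/
theorem exists_shattered (hM : IsSaturated L M) (hM' : ℵ₀ < #(Σ s, M s))
    (hA : #A < #(Σ s, M s)) {Y : L.Sorts → Type} [Finite (Σ s, Y s)]
    {Q : Tuple M X → Tuple M X → Tuple M Y → Prop}
    (hQ : Dfn₂ A fun x (y : Tuple M fun s => X s ⊕ Y s) =>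
      Q x (fun s z => y s (.inl z)) fun s z => y s (.inr z))
    {c : ℕ → Tuple M X} (hc : ∀ i, RealizesOver (U : Filter (Tuple M X)) A (c i))
    (hN : ∀ r : ℕ → ℕ, StrictMono r → ∀ P : Tuple M X → Prop, Dfn Set.univ P →
      ¬ ∀ n, P (c (r n)) ↔ Even n)
    (hS : ∀ S : ℕ → Prop, ∃ b, ∀ i, Q (c (2 * i + 1)) (c (2 * i)) b ↔ S i)
    (J : Type) [Countable J] :
    ∃ (d : Tuple M X) (b : J → Tuple M Y), ∀ σ : J → Prop,
      ∃ x, RealizesOver (U : Filter (Tuple M X)) A x ∧ ∀ j, Q x d (b j) ↔ σ j := by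
  classical
  obtain ⟨F, hF⟩ := exists_frequently_eq (Finset J)
  -- Now the `i`-th pair satisfies `Q` with exactly the `b j` for `j ∈ F i`, and each finite subset
  -- of `J` is `F i` for infinitely many `i`.
  choose b hb using fun j => hS fun i => j ∈ F i
  let C := A ∪ ⋃ j, entries (b j)
  have hC : #C < #(Σ s, M s) :=
    mk_union_lt_of_countable hM' hA (Set.countable_iUnion fun j => countable_entries _)
  have hbC : ∀ j s z, (⟨s, b j s z⟩ : Σ s, M s) ∈ C := fun j s z =>
    .inr (Set.mem_iUnion_of_mem j (mem_entries _ s z))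
  -- `d` is a limit of the even terms: it inherits all `C`-definable properties that they eventually
  -- have.
  obtain ⟨d, hd⟩ := hM.exists_realizesOver hC (Filter.map (fun i => c (2 * i)) Filter.atTop)
  refine ⟨d, b, fun σ => ?_⟩
  let ι := {P : Tuple M X → Prop // Dfn A P ∧ ∀ᶠ x in (U : Filter _), P x} ⊕ J
  let K : ι → Tuple M X → Tuple M X → Prop :=
    Sum.elim (fun P _ x => P.1 x) fun j d x => Q x d (b j) ↔ σ j
  have hK : ∀ i, Dfn₂ C (K i) := by
    rintro (P | j)
    · exact P.2.1.comp Set.subset_union_left _ fun s z => .inl ⟨.inr z, fun _ => rfl⟩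
    · refine Dfn.iff (Dfn.comp hQ Set.subset_union_left (fun (c : Tuple M fun s => X s ⊕ X s) s =>
        Sum.elim (fun z => c s (.inr z)) (Sum.elim (fun z => c s (.inl z)) (b j s))) ?_) (.const _)
      rintro s (z | z | z)
      · exact .inl ⟨_, fun _ => rfl⟩
      · exact .inl ⟨_, fun _ => rfl⟩
      · exact .inr ⟨_, hbC j s z, fun _ => rfl⟩
  obtain ⟨x, hx⟩ := hM.exists_forall
    (mk_union_lt_of_countable hM' hC (countable_entries d)) (fun i x => K i d x)
    (fun i => by
      refine Dfn.comp (hK i) Set.subset_union_left (fun x => d.join x) fun s z => ?_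
      rcases z with z | z
      · exact .inr ⟨_, .inr (mem_entries d s z), fun _ => rfl⟩
      · exact .inl ⟨z, fun _ => rfl⟩)
    (fun G => by
      have hG : Dfn C fun d => ∃ x, ∀ i ∈ G, K i d x :=
        Dfn₂.exists (Dfn.forall_mem_finset G fun i _ => hK i)
      refine hd _ hG (Filter.eventually_map.2 ?_)
      have hmono : StrictMono fun i : ℕ => 2 * i := fun i j h => by simpa using h
      -- NIP enters here: solvability in `x` need only hold for infinitely many `c (2 * i)`. It does
      -- whenever `F i` is the set of `j` in `G` with `σ j`, the solution being `c (2 * i + 1)`.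
      refine eventually_of_frequently_of_not_alternating (c := fun i => c (2 * i))
        (fun r hr => hN _ (hmono.comp hr)) (hG.mono (Set.subset_univ _)) ?_
      refine (hF (G.toRight.filter σ)).mono fun i hi => ⟨c (2 * i + 1), ?_⟩
      rintro (P | j) hj
      · exact hc _ P.1 P.2.1 P.2.2
      · show Q _ _ _ ↔ _
        rw [hb, hi, Finset.mem_filter, Finset.mem_toRight]
        exact and_iff_right hj)
  exact ⟨x, fun P hP hPU => hx (.inl ⟨P, hP, hPU⟩), fun j => hx (.inr j)⟩

/-- A shattered sequence of realizations contradicts NIP. -/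
theorem exists_indiscernible_alternating (hM : IsSaturated L M) (hM' : ℵ₀ < #(Σ s, M s))
    (hA : #A < #(Σ s, M s)) {W : L.Sorts → Type} [Finite (Σ s, W s)]
    {Q : Tuple M X → Tuple M W → Prop} (hQ : Dfn₂ A Q) {x : ℕ → Tuple M X}
    (hx : ∀ k, RealizesOver (U : Filter (Tuple M X)) A (x k))
    (hS : ∀ T : Finset ℕ, ∃ y, ∀ k, Q (x k) y ↔ k ∈ T) :
    ∃ (z : ℕ → Tuple M X) (y : Tuple M W), IsIndiscernible A z ∧
      (∀ n, RealizesOver (U : Filter (Tuple M X)) A (z n)) ∧ ∀ n, Q (z n) y ↔ Even n := by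
  classical
  let E := A ∪ ⋃ k, entries (x k)
  have hE : #E < #(Σ s, M s) :=
    mk_union_lt_of_countable hM' hA (Set.countable_iUnion fun k => countable_entries _)
  have hxE : ∀ k, entries (x k) ⊆ E := fun k =>
    (Set.subset_iUnion (fun k => entries (x k)) k).trans Set.subset_union_right
  -- A nonprincipal average type of the shattered sequence, finitely satisfiable in it; its Morley
  -- sequences over `E` are indiscernible.
  let V : Ultrafilter (Tuple M X) := (Filter.hyperfilter ℕ).map x
  have hVE : InvariantOver (V : Filter (Tuple M X)) E := invariantOver_map _ hxE
  obtain ⟨z, hz⟩ := exists_morleyOver hM hM' hE (V : Filter (Tuple M X))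
  -- The induction must keep an arbitrary pattern on finitely many `x j`: passing from `m` to `m +
  -- 1`, some fresh `x j` stands in for `z m`.
  have key : ∀ (m : ℕ) (K T : Finset ℕ), ∃ y, (∀ k < m, Q (z k) y ↔ Even k) ∧
      ∀ j ∈ K, Q (x j) y ↔ j ∈ T := by
    intro m
    induction m with
    | zero =>
      intro K T
      obtain ⟨y, hy⟩ := hS T
      exact ⟨y, by simp, fun j _ => hy j⟩
    | succ m ih =>
      intro K T
      by_contra hcon
      let C := E ∪ entriesBelow z m
      let Ψ : Tuple M X → Prop := fun t => ∃ y, ((∀ k ∈ Finset.range m, Q (z k) y ↔ Even k) ∧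
        ∀ j ∈ K, Q (x j) y ↔ j ∈ T) ∧ (Q t y ↔ Even m)
      have hΨ : Dfn C Ψ := by
        refine Dfn₂.exists ?_
        have aux : ∀ t : Tuple M X, entries t ⊆ C →
            Dfn C fun c : Tuple M (fun s => X s ⊕ W s) => Q t fun s z => c s (.inr z) := by
          intro t ht
          refine Dfn.comp hQ (Set.subset_union_left.trans Set.subset_union_left)
            (fun (c : Tuple M fun s => X s ⊕ W s) => t.join fun s z => c s (.inr z))
            fun s r => ?_
          rcases r with r | r
          · exact .inr ⟨_, ht (mem_entries _ s r), fun _ => rfl⟩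
          · exact .inl ⟨.inr r, fun _ => rfl⟩
        refine Dfn.and (Dfn.and (Dfn.forall_mem_finset _ fun k hk => (aux _ ?_).iff (.const _))
          (Dfn.forall_mem_finset _ fun j _ => (aux _ ?_).iff (.const _)))
          (Dfn.iff (Dfn.mono hQ (Set.subset_union_left.trans Set.subset_union_left)) (.const _))
        · exact (entriesBelow_subset_iff.1 le_rfl k (Finset.mem_range.1 hk)).trans
            Set.subset_union_right
        · exact (hxE j).trans Set.subset_union_left
      have hnot : ¬ Ψ (z m) := by
        rintro ⟨y, ⟨h₁, h₂⟩, h₃⟩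
        refine hcon ⟨y, fun k hk => ?_, h₂⟩
        obtain hk | rfl := Nat.lt_succ_iff_lt_or_eq.1 hk
        · exact h₁ k (Finset.mem_range.2 hk)
        · exact h₃
      have hev : ∀ᶠ k in (Filter.hyperfilter ℕ : Filter ℕ), ¬ Ψ (x k) :=
        ((hz m).eventually_iff hΨ.not).2 hnot
      have hK : ∀ᶠ k in (Filter.hyperfilter ℕ : Filter ℕ), k ∉ K :=
        Filter.hyperfilter_le_cofinite (K.finite_toSet.compl_mem_cofinite)
      obtain ⟨j, hj, hjK⟩ := (hev.and hK).exists
      -- The modified `T` gives `x j` the value required of `z m` and does not change the pattern on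
      -- `K`.
      obtain ⟨y, h₁, h₂⟩ := ih (insert j K) (if Even m then insert j T else T.erase j)
      refine hj ⟨y, ⟨fun k hk => h₁ k (Finset.mem_range.1 hk), fun i hi => ?_⟩, ?_⟩
      · rw [h₂ i (Finset.mem_insert_of_mem hi)]
        have : i ≠ j := fun h => hjK (h ▸ hi)
        split_ifs <;> simp [this]
      · rw [h₂ j (Finset.mem_insert_self _ _)]
        split_ifs with h <;> simp [h]
  have hsmall : #(A ∪ ⋃ k, entries (z k) : Set (Σ s, M s)) < #(Σ s, M s) :=
    mk_union_lt_of_countable hM' hA (Set.countable_iUnion fun k => countable_entries _)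
  obtain ⟨y, hy⟩ := hM.exists_forall hsmall (fun n y => Q (z n) y ↔ Even n)
    (fun n => by
      refine Dfn.iff (Dfn.comp hQ Set.subset_union_left (fun y => (z n).join y) fun s t => ?_)
        (.const _)
      rcases t with t | t
      · exact .inr ⟨_, .inr (Set.mem_iUnion_of_mem n (mem_entries _ s t)), fun _ => rfl⟩
      · exact .inl ⟨t, fun _ => rfl⟩)
    (fun G => by
      obtain ⟨y, hy, -⟩ := key (G.sup id + 1) ∅ ∅
      exact ⟨y, fun k hk => hy k (Nat.lt_succ_of_le (Finset.le_sup (f := id) hk))⟩)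
  refine ⟨z, y, (IsIndiscernible.of_morleyOver hVE hz).mono Set.subset_union_left,
    fun n P hP hPU => ?_, hy⟩
  refine hz n P (hP.mono (Set.subset_union_left.trans Set.subset_union_left)) ?_
  exact Filter.eventually_map.2 (Filter.Eventually.of_forall fun k => hx k P hP hPU)

end OrderTrivial

/-! ### The one-step property, ultrafilters for global types, and the theorem -/

section MainResult

variable {L : Language.{u, v}} {M : L.Sorts → Type w} {A B : Set (Σ s, M s)}
  {X : L.Sorts → Type}

theorem countable_entriesBelow [Finite (Σ s, X s)] (a : ℕ → Tuple M X) (n : ℕ) :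
    (entriesBelow a n).Countable := by
  refine (Set.countable_iUnion fun j => countable_entries (a j)).mono
    (entriesBelow_subset_iff.2 fun j _ => Set.subset_iUnion (fun j => entries (a j)) j)

variable [Struct L M]

/-- Patterns of a relation on pairs transfer between Morley sequences. -/
theorem MorleyOver.exists_pattern [Finite (Σ s, X s)] {U : Ultrafilter (Tuple M X)}
    (hM : IsSaturated L M) (hM' : ℵ₀ < #(Σ s, M s)) (hA : #A < #(Σ s, M s))
    (hU : InvariantOver (U : Filter (Tuple M X)) A)
    {Y : L.Sorts → Type} [Finite (Σ s, Y s)] {Q : Tuple M X → Tuple M X → Tuple M Y → Prop}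
    (hQ : Dfn₂ A fun x (y : Tuple M fun s => X s ⊕ Y s) =>
      Q x (fun s z => y s (.inl z)) fun s z => y s (.inr z))
    {c c' : ℕ → Tuple M X} (hc : MorleyOver (U : Filter (Tuple M X)) A c)
    (hc' : MorleyOver (U : Filter (Tuple M X)) A c') {b : Tuple M Y} {S : ℕ → Prop}
    (hb : ∀ i, Q (c (2 * i + 1)) (c (2 * i)) b ↔ S i) :
    ∃ b', ∀ i, Q (c' (2 * i + 1)) (c' (2 * i)) b' ↔ S i := by
  let C := A ∪ ⋃ k, entries (c' k)
  have hC : #C < #(Σ s, M s) :=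
    mk_union_lt_of_countable hM' hA (Set.countable_iUnion fun k => countable_entries _)
  have hcC : ∀ k s z, (⟨s, c' k s z⟩ : Σ s, M s) ∈ C := fun k s z =>
    .inr (Set.mem_iUnion_of_mem k (mem_entries _ s z))
  refine hM.exists_forall hC (fun i y => Q (c' (2 * i + 1)) (c' (2 * i)) y ↔ S i)
    (fun i => Dfn.iff (Dfn.comp hQ Set.subset_union_left
      (fun y => (c' (2 * i + 1)).join ((c' (2 * i)).join y)) ?_) (.const _)) fun G => ?_
  · rintro s (z | z | z)
    · exact .inr ⟨_, hcC _ s z, fun _ => rfl⟩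
    · exact .inr ⟨_, hcC _ s z, fun _ => rfl⟩
    · exact .inl ⟨z, fun _ => rfl⟩
  · let N := G.sup id + 1
    -- By saturation finitely many `i` suffice; existence of `y` for them is part of the type over
    -- `A` of the first `2 * N` terms.
    let P : Tuple M (fun s => Fin (2 * N) × X s) → Prop := fun t => ∃ y,
      ∀ i ∈ (Finset.univ : Finset (Fin N)),
        Q (fun s z => t s (⟨2 * i.1 + 1, by omega⟩, z))
          (fun s z => t s (⟨2 * i.1, by omega⟩, z)) y ↔ S i
    have hP : Dfn A P := by
      refine Dfn₂.exists (Dfn.forall_mem_finset _ fun i _ => Dfn.iff (Dfn.comp hQ le_rfl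
        (fun (t : Tuple M fun s => (Fin (2 * N) × X s) ⊕ Y s) s =>
          Sum.elim (fun z => t s (.inl (⟨2 * i.1 + 1, by omega⟩, z)))
            (Sum.elim (fun z => t s (.inl (⟨2 * i.1, by omega⟩, z))) fun z => t s (.inr z))) ?_)
        (.const _))
      rintro s (z | z | z) <;> exact .inl ⟨_, fun _ => rfl⟩
    have hmono : StrictMono fun i : Fin (2 * N) => (i : ℕ) := fun _ _ h => h
    obtain ⟨y, hy⟩ := (tp_eq_iff.1 (hc.tp_concat_eq hU hc' hmono hmono) P hP).1
      ⟨b, fun i _ => hb i⟩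
    exact ⟨y, fun i hi => hy ⟨i, Nat.lt_succ_of_le (Finset.le_sup (f := id) hi)⟩
      (Finset.mem_univ _)⟩

/-- A counterexample lets `R` be switched freely on successive pairs, while order-triviality makes
the resulting chains indistinguishable over `A`; together these contradict NIP. -/
theorem RealizesOver.union_entries [Finite (Σ s, X s)] {U : Ultrafilter (Tuple M X)}
    (hM : IsSaturated L M) (hM' : ℵ₀ < #(Σ s, M s)) (hA : #A < #(Σ s, M s))
    (hU : InvariantOver (U : Filter (Tuple M X)) A)
    (hOT : ∀ c : ℕ → Tuple M X, RealizesOver (U : Filter (Tuple M X)) A (c 0) →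
      (∀ i, RealizesOver (U : Filter (Tuple M X)) (A ∪ entries (c i)) (c (i + 1))) →
      MorleyOver (U : Filter (Tuple M X)) A c)
    (hN : ∀ z : ℕ → Tuple M X, IsIndiscernible A z →
      (∀ n, RealizesOver (U : Filter (Tuple M X)) A (z n)) →
      ∀ P : Tuple M X → Prop, Dfn Set.univ P → ¬ ∀ n, P (z n) ↔ Even n)
    (hAB : A ⊆ B) (hB : #B < #(Σ s, M s)) {a₀ a₁ : Tuple M X}
    (h₀ : RealizesOver (U : Filter (Tuple M X)) B a₀)
    (h₁ : RealizesOver (U : Filter (Tuple M X)) (A ∪ entries a₀) a₁) :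
    RealizesOver (U : Filter (Tuple M X)) (B ∪ entries a₀) a₁ := by
  intro P hP hPU
  by_contra hPa
  obtain ⟨Z, _, T, e, hT, he, hPT⟩ := hP.exists_eq_apply
  choose k hk using he
  have hke : (fun s z => a₀ s (k s z)) = e := funext fun s => funext fun z => hk s z
  let R : Tuple M X → Tuple M X → Prop := fun x x₀ => T x fun s z => x₀ s (k s z)
  have hR : Dfn₂ B R := by
    refine Dfn.comp hT le_rfl (fun (c : Tuple M fun s => X s ⊕ X s) s =>
      Sum.elim (fun z => c s (.inl z)) fun z => c s (.inr (k s z))) fun s z => ?_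
    cases z <;> exact .inl ⟨_, fun _ => rfl⟩
  have hPR : ∀ x, P x ↔ R x a₀ := fun x => by rw [hPT, ← hke]
  have chain := exists_chain_pattern hM hM' hU hAB hB h₀ h₁ hR (hPU.mono fun x => (hPR x).1)
    (fun h => hPa ((hPR a₁).2 h))
  have hR' := hR
  rw [← Set.union_eq_self_of_subset_left hAB] at hR'
  obtain ⟨Y, _, Q, b, hQ, -, hRQ⟩ := hR'.exists_eq_apply
  have hRQ' : ∀ x d, R x d ↔ Q (x.join d) b := fun x d => hRQ (x.join d)
  have hQ' : Dfn₂ A fun x (y : Tuple M fun s => X s ⊕ Y s) =>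
      Q (x.join fun s z => y s (.inl z)) fun s z => y s (.inr z) := by
    refine (Dfn.comp hQ le_rfl (fun (c : Tuple M fun s => X s ⊕ (X s ⊕ Y s)) s =>
      Sum.elim (Sum.elim (fun z => c s (.inl z)) fun z => c s (.inr (.inl z)))
        fun z => c s (.inr (.inr z))) ?_).congr fun c => ?_
    · rintro s ((z | z) | z) <;> exact .inl ⟨_, fun _ => rfl⟩
    · refine iff_of_eq (congrFun (congrArg Q ?_) _)
      funext s z
      cases z <;> rfl
  -- The pattern is immaterial: `c` only serves as the reference sequence to which all patterns are
  -- moved.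
  obtain ⟨c, hc₀, hc, -⟩ := chain fun _ => False
  have hcM := hOT c hc₀ hc
  have hcA : ∀ i, RealizesOver (U : Filter (Tuple M X)) A (c i) := fun i =>
    (hcM i).mono Set.subset_union_left
  have hcI := IsIndiscernible.of_morleyOver hU hcM
  obtain ⟨d, b', hd⟩ := exists_shattered (Q := fun x d b => Q (x.join d) b) hM hM' hA hQ' hcA
    (fun r hr => hN _ (hcI.comp hr) fun n => hcA (r n))
    (fun S => by
      obtain ⟨c', hc₀', hc', hS⟩ := chain S
      exact (hOT c' hc₀' hc').exists_pattern (Q := fun x d b => Q (x.join d) b) hM hM' hA hU hQ' hcM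
        fun i => (hRQ' _ _).symm.trans (hS i))
    (Finset ℕ)
  -- Roles are exchanged: with parameters indexed by finite sets `T`, the `k`-th realization
  -- satisfies exactly the instances with `k ∈ T`, so the sequence `x` is itself shattered.
  choose x hxA hx using fun k : ℕ => hd fun T => k ∈ T
  have : Finite (Σ s, X s ⊕ Y s) := Finite.of_equiv _ (Equiv.sigmaSumDistrib X Y).symm
  obtain ⟨z, y, hzI, hzA, hzy⟩ := exists_indiscernible_alternating hM hM' hA hQ' hxA
    fun T => ⟨d.join (b' T), fun k => hx k T⟩
  refine hN z hzI hzA (fun x => Q (x.join fun s z => y s (.inl z)) fun s z => y s (.inr z)) ?_ hzy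
  exact Dfn₂.apply hQ' (Set.subset_univ _) y fun _ _ => Set.mem_univ _

theorem MorleyOver.of_realizesOver [Finite (Σ s, X s)] {U : Ultrafilter (Tuple M X)}
    (hM : IsSaturated L M) (hM' : ℵ₀ < #(Σ s, M s)) (hA : #A < #(Σ s, M s))
    (hU : InvariantOver (U : Filter (Tuple M X)) A)
    (hOT : ∀ c : ℕ → Tuple M X, RealizesOver (U : Filter (Tuple M X)) A (c 0) →
      (∀ i, RealizesOver (U : Filter (Tuple M X)) (A ∪ entries (c i)) (c (i + 1))) →
      MorleyOver (U : Filter (Tuple M X)) A c)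
    (hN : ∀ z : ℕ → Tuple M X, IsIndiscernible A z →
      (∀ n, RealizesOver (U : Filter (Tuple M X)) A (z n)) →
      ∀ P : Tuple M X → Prop, Dfn Set.univ P → ¬ ∀ n, P (z n) ↔ Even n)
    (hAB : A ⊆ B) (hB : #B < #(Σ s, M s)) {a : ℕ → Tuple M X}
    (ha : MorleyOver (U : Filter (Tuple M X)) A a)
    (h₀ : RealizesOver (U : Filter (Tuple M X)) B (a 0)) :
    MorleyOver (U : Filter (Tuple M X)) B a := by
  intro n
  induction n with
  | zero => exact h₀.mono (Set.union_subset le_rfl (entriesBelow_subset_iff.2 fun j hj =>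
      absurd hj (by simp)))
  | succ n ih =>
    rw [entriesBelow_succ, ← Set.union_assoc]
    refine RealizesOver.union_entries hM hM' hA hU hOT hN (hAB.trans Set.subset_union_left)
      (mk_union_lt_of_countable hM' hB (countable_entriesBelow a n)) ih ((ha (n + 1)).mono ?_)
    rw [entriesBelow_succ]
    exact Set.union_subset_union_right _ Set.subset_union_right

/-- Finite satisfiability makes the solution sets generate a proper filter, which extends to an
ultrafilter; completeness of `p` excludes any further formula. -/
theorem IsCompleteType.exists_ultrafilter {p : GlobalSet M X} (hp : IsCompleteType p) :
    ∃ U : Ultrafilter (Tuple M X), ∀ φ, φ ∈ p ↔ ∀ᶠ x in (U : Filter (Tuple M X)), φ.Holds x := by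
  classical
  let V := Filter.generate ((fun φ => {a | φ.Holds a}) '' p)
  have : V.NeBot := by
    refine Filter.generate_neBot_iff.2 fun t ht hfin => ?_
    lift t to Finset (Set (Tuple M X)) using hfin
    obtain ⟨F, hF, rfl⟩ := Finset.subset_set_image_iff.1 ht
    obtain ⟨a, ha⟩ := hp.finitely_satisfiable F hF F.finite_toSet
    refine ⟨a, ?_⟩
    simp only [Finset.coe_image, Set.sInter_image, Set.mem_iInter]
    exact fun φ hφ => ha φ hφ
  have hV : ∀ φ ∈ p, ∀ᶠ x in (Ultrafilter.of V : Filter (Tuple M X)), φ.Holds x := fun φ hφ =>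
    Ultrafilter.of_le V (Filter.mem_generate_of_mem ⟨φ, hφ, rfl⟩)
  refine ⟨Ultrafilter.of V, fun φ => ⟨hV φ, fun h => (hp.complete φ).resolve_right fun hn => ?_⟩⟩
  exact Ultrafilter.eventually_not.1 (hV _ hn) h

section

variable {p : GlobalSet M X} {U : Ultrafilter (Tuple M X)}
  (hpU : ∀ φ, φ ∈ p ↔ ∀ᶠ x in (U : Filter (Tuple M X)), φ.Holds x)
include hpU

theorem realizes_on_iff {C : Set (Σ s, M s)} {a : Tuple M X} :
    Realizes a (p.on C) ↔ RealizesOver (U : Filter (Tuple M X)) C a := by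
  have hon : ∀ φ : ParamFormula C X, φ ∈ p.on C ↔ ∀ᶠ x in (U : Filter (Tuple M X)), φ.Holds x := by
    intro φ
    simp only [← ParamFormula.holds_lift (Set.subset_univ C)]
    exact hpU _
  constructor
  · rintro h P ⟨φ, hφ⟩ hP
    exact (hφ a).1 (h φ ((hon φ).2 (hP.mono fun x => (hφ x).2)))
  · exact fun h φ hφ => h _ (Dfn.holds φ) ((hon φ).1 hφ)

theorem isMorley_iff {a : ℕ → Tuple M X} :
    IsMorley p A a ↔ MorleyOver (U : Filter (Tuple M X)) A a :=
  forall_congr' fun _ => realizes_on_iff hpU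

theorem isMorley_pair_iff {a b : Tuple M X} :
    IsMorley p A ![a, b] ↔ RealizesOver (U : Filter (Tuple M X)) A a ∧
      RealizesOver (U : Filter (Tuple M X)) (A ∪ entries a) b := by
  have h0 : entriesBelow ![a, b] (0 : Fin 2) = ∅ :=
    Set.subset_empty_iff.1 (entriesBelow_subset_iff.2 fun j hj => absurd hj (by simp))
  have h1 : entriesBelow ![a, b] (1 : Fin 2) = entries a := by
    apply Set.Subset.antisymm
    · refine entriesBelow_subset_iff.2 fun j hj => ?_
      obtain rfl : j = (0 : Fin 2) := (Fin.lt_one_iff j).1 hj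
      exact le_rfl
    · exact fun e he => ⟨0, by decide, he⟩
  unfold IsMorley
  rw [Fin.forall_fin_two, realizes_on_iff hpU, realizes_on_iff hpU, h0, h1, Set.union_empty]
  rfl

theorem isInvariant_iff : IsInvariant p A ↔ InvariantOver (U : Filter (Tuple M X)) A := by
  constructor
  · rintro h Y _ R ⟨φ, hφ⟩ b₁ b₂ hb hR
    have := (hpU _).1 (h Y φ b₁ b₂ hb)
    filter_upwards [this, hR] with x hx hxR
    rw [ParamFormula.holds_iff, ParamFormula.holds_plug, ParamFormula.holds_plug, hφ, hφ] at hx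
    exact hx.1 hxR
  · intro h Y _ φ b₁ b₂ hb
    have key : ∀ {b₁ b₂ : Tuple M Y}, tp A b₁ = tp A b₂ →
        ∀ {ψ : ParamFormula A fun s => X s ⊕ Y s},
        (∀ᶠ x in (U : Filter (Tuple M X)), (ψ.plug b₁).Holds x) →
        ∀ᶠ x in (U : Filter (Tuple M X)), (ψ.plug b₂).Holds x := by
      intro b₁ b₂ hb ψ
      simp only [ParamFormula.holds_plug]
      refine h Y (fun x b => ψ.Holds (x.join b)) ((Dfn.holds ψ).congr fun c => ?_) b₁ b₂ hb
      refine iff_of_eq (congrArg _ (funext fun s => funext fun z => ?_))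
      cases z <;> rfl
    rw [hpU]
    simp only [ParamFormula.holds_iff]
    by_cases hφ : ∀ᶠ x in (U : Filter (Tuple M X)), (φ.plug b₁).Holds x
    · filter_upwards [hφ, key hb hφ] with x h₁ h₂ using iff_of_true h₁ h₂
    · have hφ' : ¬ ∀ᶠ x in (U : Filter (Tuple M X)), (φ.plug b₂).Holds x :=
        fun h => hφ (key hb.symm h)
      filter_upwards [Ultrafilter.eventually_not.2 hφ, Ultrafilter.eventually_not.2 hφ'] with
        x h₁ h₂ using iff_of_false h₁ h₂

theorem IsNIP.not_alternating (hN : IsNIP (p.on A)) (z : ℕ → Tuple M X) (hz : IsIndiscernible A z)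
    (hzA : ∀ n, RealizesOver (U : Filter (Tuple M X)) A (z n)) (P : Tuple M X → Prop)
    (hP : Dfn Set.univ P) : ¬ ∀ n, P (z n) ↔ Even n := by
  intro hPz
  -- Splitting the parameters as `∅ ∪ univ` turns all of them into a finite tuple `b` and leaves a
  -- formula without parameters, as `IsNIP` demands.
  rw [← Set.empty_union Set.univ] at hP
  obtain ⟨Y, hY, R, b, ⟨φ, hφ⟩, -, hPR⟩ := hP.exists_eq_apply
  refine hN ⟨Y, hY, φ.rename fun s => Sum.elim id fun m => absurd m.2 (Set.notMem_empty _), z, b,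
    hz, fun n => (realizes_on_iff hpU).2 (hzA n), fun n => ?_⟩
  rw [← hPz n, hPR, Formula.realize_rename]
  refine Iff.trans ?_ (hφ ((z n).join b))
  refine iff_of_eq (congrArg _ (funext fun s => funext fun t => ?_))
  rcases t with t | t
  · rfl
  · exact absurd t.2 (Set.notMem_empty _)

end

end MainResult

end ManySorted

theorem mainTheorem5 (L : ManySorted.Language.{u, v}) (M : L.Sorts → Type w)
    [ManySorted.Struct L M] (hM : ManySorted.IsMonster L M)
    (X : L.Sorts → Type) [Finite (Σ s, X s)]
    (p : ManySorted.GlobalSet M X) (hp : ManySorted.IsCompleteType p)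
    (A : Set (Σ s, M s)) (hA : #A < #(Σ s, M s))
    (hpA : ManySorted.IsOrderTrivial p A) (hNIP : ManySorted.IsNIP (p.on A)) :
    (∀ B : Set (Σ s, M s), A ⊆ B → #B < #(Σ s, M s) → ManySorted.IsOrderTrivial p B) ∧
    (∀ a : ℕ → ManySorted.Tuple M X, ManySorted.IsMorley p A a →
      ∀ B : Set (Σ s, M s), A ⊆ B → #B < #(Σ s, M s) →
        (ManySorted.IsMorley p B a ↔ ManySorted.Realizes (a 0) (p.on B))) := by
  obtain ⟨U, hpU⟩ := hp.exists_ultrafilter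
  have hU := (ManySorted.isInvariant_iff hpU).1 hpA.invariant
  have hOT : ∀ c : ℕ → ManySorted.Tuple M X,
      ManySorted.RealizesOver (U : Filter (ManySorted.Tuple M X)) A (c 0) →
      (∀ i, ManySorted.RealizesOver (U : Filter (ManySorted.Tuple M X))
        (A ∪ ManySorted.entries (c i)) (c (i + 1))) →
      ManySorted.MorleyOver (U : Filter (ManySorted.Tuple M X)) A c := by
    intro c h₀ h
    refine (ManySorted.isMorley_iff hpU).1 (hpA.isMorley c fun i =>
      (ManySorted.isMorley_pair_iff hpU).2 ⟨?_, h i⟩)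
    cases i with
    | zero => exact h₀
    | succ i => exact (h i).mono Set.subset_union_left
  have main : ∀ a : ℕ → ManySorted.Tuple M X, ManySorted.IsMorley p A a →
      ∀ B : Set (Σ s, M s), A ⊆ B → #B < #(Σ s, M s) →
        (ManySorted.IsMorley p B a ↔ ManySorted.Realizes (a 0) (p.on B)) := by
    intro a ha B hAB hB
    rw [ManySorted.isMorley_iff hpU, ManySorted.realizes_on_iff hpU]
    refine ⟨fun h => (h 0).mono Set.subset_union_left, fun h => ?_⟩
    exact ManySorted.MorleyOver.of_realizesOver hM.saturated hM.uncountable hA hU hOT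
      (hNIP.not_alternating hpU) hAB hB ((ManySorted.isMorley_iff hpU).1 ha) h
  refine ⟨fun B hAB hB => ⟨hpA.nonAlgebraic, (ManySorted.isInvariant_iff hpU).2 (hU.mono hAB),
    fun a ha => ?_⟩, main⟩
  simp only [ManySorted.isMorley_pair_iff hpU] at ha
  -- Pairs that are Morley over `B` are Morley over `A`, so `a` is Morley over `A`; since `a 0`
  -- realizes `p` over `B`, part (2) applies.
  refine (main a ((ManySorted.isMorley_iff hpU).2 (hOT a ((ha 0).1.mono hAB) fun i =>
    (ha i).2.mono (Set.union_subset_union_left _ hAB))) B hAB hB).2 ?_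
  exact (ManySorted.realizes_on_iff hpU).2 (ha 0).1
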